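/- Let $d\ge 2$, $I=(-1/2,1/2)$, and let $Q\subset\mathbb R^{d-1}$ be a bounded Lipschitz domain (in particular connected) containing the origin. Let $\square=\mathbb T^1\times Q$ with $\mathbb T^1$ the one-dimensional torus of length $1$, let $\alpha>0$, and write $x=(x_1,x')\in\mathbb R\times\mathbb R^{d-1}$ and $y=(y_1,y')$. Let $F(x_1,y)\in C^{1,\alpha}(\overline I\times\overline I\times\overline Q)$ be $1$-periodic in $y_1$, with $F(x_1,0)=-1$, $F\ge\mathrm{const}>0$ on $y_1=\pm\frac12$, and $\nabla_yF\ne0$ for $y\neq0$. For $\varepsilon=1/(2N+1)$, $N\in\mathbb N$, put $$G_\varepsilon=I\times\varepsilon Q,\qquad \Gamma^\pm_\varepsilon=\{\pm\tfrac12\}\times\varepsilon Q,\qquad \Omega_\varepsilon=\{x\in G_\varepsilon: F(x_1,x/\varepsilon)>0\},$$ $$Y(x_1)=\{y\in\square: F(x_1,y)>0\},$$ and let $\chi(x_1,\cdot)$ be the characteristic function of $Y(x_1)$, extended $1$-periodically in $y_1$. (i) Let $w\in C^{1,\alpha}(\overline I;C^\alpha(\overline\square))$. There are constants $C$ and $\varepsilon_0>0$,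 depending only on $d,Q,\alpha,F,w$, such that for all $\varepsilon=1/(2N+1)<\varepsilon_0$ and all $v\in H^1(G_\varepsilon)$ with $v=0$ on $\Gamma_\varepsilon^\pm$, $$\Big|\int_{\Omega_\varepsilon}w\big(x_1,\tfrac x\varepsilon\big)v^2\,dx-\frac1{|\square|}\int_{G_\varepsilon}\Big(\int_{Y(x_1)}w(x_1,y)\,dy\Big)v^2\,dx\Big|\le C\,\varepsilon\,\|v\|_{L^2(G_\varepsilon)}\|\nabla v\|_{L^2(G_\varepsilon)}.$$ (ii) Let $\mu_\varepsilon$ be the measure $\frac{\varepsilon^{-3(d-1)/4}}{|Q|}\,\mathbf 1_{\varepsilon^{-1/4}G_\varepsilon}\,dz$ on $\mathbb R^d$. Let $c\in C^{1,\alpha}(\mathbb R;C^\alpha(\overline\square))$ (only the restriction of $c$ to $x_1\in\overline I$, of class $C^{1,\alpha}(\overline I;C^\alpha(\overline\square))$, is used) and $\bar c(x_1)=\frac1{|Y(x_1)|}\int_{Y(x_1)}c(x_1,y)\,dy$. There are constants $C$ and $\varepsilon_0>0$, depending only on $d,Q,\alpha,F,c$, such that for all $\varepsilon=1/(2N+1)<\varepsilon_0$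 and all $v\in H^1(\mathbb R^d,\mu_\varepsilon)$ with $v=0$ on $\varepsilon^{-1/4}\Gamma^\pm_\varepsilon$, $$\Big|\int_{\mathbb R^d}(\chi c)\big(\varepsilon^{1/4}z_1,\tfrac z{\varepsilon^{3/4}}\big)v^2\,d\mu_\varepsilon-\frac1{|\square|}\int_{\mathbb R^d}|Y(\varepsilon^{1/4}z_1)|\,\bar c(\varepsilon^{1/4}z_1)\,v^2\,d\mu_\varepsilon\Big|\le C\,\varepsilon^{3/4}\,\|v\|_{L^2(\mathbb R^d,\mu_\varepsilon)}\|\nabla v\|_{L^2(\mathbb R^d,\mu_\varepsilon)}.$$ Here $H^1(\mathbb R^d,\mu_\varepsilon)$ consists of the $L^2(\mu_\varepsilon)$-limits of functions $\varphi_k\in C_c^\infty(\mathbb R^d)$ whose gradients also converge in $L^2(\mu_\varepsilon)^d$ (the limit of the gradients being $\nabla v$). In both parts, "$v=0$" on the ends of the rod means that $v$ lies in the $H^1$-closure of the smooth functions that vanish there. -/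

import Mathlib

open MeasureTheory Set
open scoped Pointwise ContDiff

namespace ThinRod

noncomputable section

/-- The cross-section space `ℝ^(d-1)`, where `n = d - 1`, with its Euclidean norm. -/
abbrev Cross (n : ℕ) : Type := EuclideanSpace ℝ (Fin n)

/-- The space `ℝ^d = ℝ × ℝ^(d-1)` with points `x = (x₁, x')`. Its measure `volume` is the Lebesgue
measure. The Euclidean length of a vector is computed by `sqLen` below. -/
abbrev Space (n : ℕ) : Type := ℝ × Cross n

variable {n : ℕ}

/-- A bounded Lipschitz domain: a bounded, open, connected set which near every boundary point is,
in suitable orthonormal coordinates, the strict epigraph of a Lipschitz function. The unit vector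
`e` is the vertical direction, `x - ⟪e, x⟫ e` is the horizontal part of `x`. -/
def IsLipschitzDomain (Q : Set (Cross n)) : Prop :=
  IsOpen Q ∧ IsConnected Q ∧ Bornology.IsBounded Q ∧
    ∀ p ∈ frontier Q, ∃ (e : Cross n) (L : NNReal) (h : Cross n → ℝ) (r : ℝ),
      ‖e‖ = 1 ∧ LipschitzWith L h ∧ 0 < r ∧
        ∀ x ∈ Metric.ball p r, x ∈ Q ↔ h (x - (inner ℝ e x) • e) < inner ℝ e x

/-- The closed interval `[-1/2, 1/2]`. -/
def closedI : Set ℝ := Icc (-1 / 2) (1 / 2)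

/-- The open interval `I = (-1/2, 1/2)`. -/
def openI : Set ℝ := Ioo (-1 / 2) (1 / 2)

/-- The periodicity cell `□ = 𝕋¹ × Q`, the torus being represented by the fundamental domain
`[-1/2, 1/2)`. -/
def cell (Q : Set (Cross n)) : Set (Space n) := Ico (-1 / 2) (1 / 2) ×ˢ Q

/-- `F(x₁, y₁, y')` describes an admissible perforation: it belongs to
`C^{1,α}([-1/2,1/2] × [-1/2,1/2] × closure Q)` (it is continuous there, and differentiable in the
interior with a derivative that extends to an `α`-Hölder function `DF` on the closed set), is
`1`-periodic in `y₁`, equals `-1` at `y = 0`, is bounded below by a positive constant on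
`y₁ = ± 1/2`, and has nonzero `y`-gradient for `y ≠ 0`. -/
def IsPerforation (Q : Set (Cross n)) (α : ℝ) (F : ℝ → Space n → ℝ) : Prop :=
  (∃ DF : ℝ × Space n → (ℝ × Space n →L[ℝ] ℝ),
    ContinuousOn (fun p : ℝ × Space n => F p.1 p.2) (closedI ×ˢ (closedI ×ˢ closure Q)) ∧
    (∀ p ∈ openI ×ˢ (openI ×ˢ Q),
      HasFDerivAt (fun p : ℝ × Space n => F p.1 p.2) (DF p) p) ∧
    (∃ K : ℝ, ∀ p ∈ closedI ×ˢ (closedI ×ˢ closure Q),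
      ∀ q ∈ closedI ×ˢ (closedI ×ˢ closure Q), ‖DF p - DF q‖ ≤ K * dist p q ^ α) ∧
    (∀ p ∈ closedI ×ˢ (closedI ×ˢ closure Q), p.2 ≠ 0 →
      ∃ h : Space n, DF p (0, h) ≠ 0)) ∧
  (∀ s ∈ closedI, ∀ t : ℝ, ∀ y ∈ closure Q, F s (t + 1, y) = F s (t, y)) ∧
  (∀ s ∈ closedI, F s 0 = -1) ∧
  (∃ κ : ℝ, 0 < κ ∧ ∀ s ∈ closedI, ∀ y ∈ closure Q, κ ≤ F s (1 / 2, y) ∧ κ ≤ F s (-1 / 2, y))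

/-- Both the supremum and the `α`-Hölder seminorm of `f` on `S` are at most `M`; up to equivalence
of norms this says that the norm of `f` in `C^α(S)` is at most `M`. -/
def HolderBound (α : ℝ) (S : Set (Space n)) (f : Space n → ℝ) (M : ℝ) : Prop :=
  (∀ y ∈ S, |f y| ≤ M) ∧ ∀ y ∈ S, ∀ z ∈ S, |f y - f z| ≤ M * dist y z ^ α

/-- `w ∈ C^{1,α}([-1/2,1/2]; C^α(closure □))`: each `w(s, ·)` is a function on the closed cell
`𝕋¹ × closure Q` (a function on `ℝ × closure Q` that is `1`-periodic in `y₁`) of class `C^α`, the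
map `s ↦ w(s, ·)` is differentiable into `C^α`, and its derivative `w'` is `α`-Hölder into `C^α`. -/
def IsC1HolderWeight (Q : Set (Cross n)) (α : ℝ) (w : ℝ → Space n → ℝ) : Prop :=
  (∀ s ∈ closedI, ∀ t : ℝ, ∀ y ∈ closure Q, w s (t + 1, y) = w s (t, y)) ∧
  (∀ s ∈ closedI, ∃ M, HolderBound α (univ ×ˢ closure Q) (w s) M) ∧
  ∃ w' : ℝ → Space n → ℝ,
    (∀ s ∈ closedI, ∃ M, HolderBound α (univ ×ˢ closure Q) (w' s) M) ∧
    (∀ s ∈ closedI, ∀ η > 0, ∃ δ > 0, ∀ t ∈ closedI, |t - s| < δ →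
      HolderBound α (univ ×ˢ closure Q)
        (fun y => w t y - w s y - (t - s) * w' s y) (η * |t - s|)) ∧
    ∃ K : ℝ, ∀ s ∈ closedI, ∀ t ∈ closedI,
      HolderBound α (univ ×ˢ closure Q) (fun y => w' t y - w' s y) (K * |t - s| ^ α)

/-- The rod `G_ε = I × εQ`. -/
def rod (Q : Set (Cross n)) (ε : ℝ) : Set (Space n) := openI ×ˢ (ε • Q)

/-- The union `Γ_ε⁺ ∪ Γ_ε⁻` of the two ends `{± 1/2} × εQ` of the rod. -/
def rodEnds (Q : Set (Cross n)) (ε : ℝ) : Set (Space n) :=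
  ({1 / 2, -1 / 2} : Set ℝ) ×ˢ (ε • Q)

/-- The perforated rod `Ω_ε = {x ∈ G_ε : F(x₁, x/ε) > 0}`. -/
def perforatedRod (Q : Set (Cross n)) (F : ℝ → Space n → ℝ) (ε : ℝ) : Set (Space n) :=
  {x ∈ rod Q ε | 0 < F x.1 (ε⁻¹ • x)}

/-- The perforated cell `Y(s) = {y ∈ □ : F(s, y) > 0}`. -/
def perforatedCell (Q : Set (Cross n)) (F : ℝ → Space n → ℝ) (s : ℝ) : Set (Space n) :=
  {y ∈ cell Q | 0 < F s y}

/-- The average `(1/|Y(s)|) ∫_{Y(s)} c(s, y) dy`. -/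
def cellAverage (Q : Set (Cross n)) (F c : ℝ → Space n → ℝ) (s : ℝ) : ℝ :=
  (volume.real (perforatedCell Q F s))⁻¹ * ∫ y in perforatedCell Q F s, c s y

/-- The square of the Euclidean length of a vector of `ℝ × ℝ^(d-1)`. -/
def sqLen (a : Space n) : ℝ := a.1 ^ 2 + ‖a.2‖ ^ 2

/-- The classical gradient `(∂₁φ, ∇'φ)`. -/
def grad (φ : Space n → ℝ) (x : Space n) : Space n :=
  (fderiv ℝ φ x (1, 0), WithLp.toLp 2 fun i => fderiv ℝ φ x (0, EuclideanSpace.single i 1))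

/-- The `L²(μ)` norm of a scalar function. -/
def normL2 (μ : Measure (Space n)) (v : Space n → ℝ) : ℝ := Real.sqrt (∫ x, v x ^ 2 ∂μ)

/-- The `L²(μ)` norm of a vector field. -/
def normL2Vec (μ : Measure (Space n)) (g : Space n → Space n) : ℝ :=
  Real.sqrt (∫ x, sqLen (g x) ∂μ)

/-- `v ∈ L²(μ)` and `g ∈ L²(μ)^d` are the limits in `L²(μ)` of `φ_k` and of `∇φ_k` for functions
`φ_k ∈ C_c^∞(ℝ^d)` that vanish on `Γ`. With `Γ = ∅` this says that `v ∈ H¹(ℝ^d, μ)` and that `g` is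
a `μ`-gradient of `v`; in general it says in addition that `v = 0` on `Γ`. -/
def InSobolevVanishing (μ : Measure (Space n)) (Γ : Set (Space n))
    (v : Space n → ℝ) (g : Space n → Space n) : Prop :=
  MemLp v 2 μ ∧ MemLp g 2 μ ∧
    ∀ η > 0, ∃ φ : Space n → ℝ, ContDiff ℝ ∞ φ ∧ HasCompactSupport φ ∧ (∀ x ∈ Γ, φ x = 0) ∧
      normL2 μ (fun x => v x - φ x) < η ∧ normL2Vec μ (fun x => g x - grad φ x) < η

/-- `g` is the weak gradient of `v` on the open set `G`. -/
def HasWeakGrad (G : Set (Space n)) (v : Space n → ℝ) (g : Space n → Space n) : Prop :=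
  ∀ φ : Space n → ℝ, ContDiff ℝ ∞ φ → HasCompactSupport φ → tsupport φ ⊆ G →
    ∫ x in G, v x • grad φ x = -∫ x in G, φ x • g x

/-- `v ∈ H¹₀(G_ε, Γ_ε^±)` with weak gradient `g`: `v` is in `H¹(G_ε)` and vanishes on the ends of
the rod, in the sense that it is in the `H¹(G_ε)`-closure of the smooth functions that do. -/
def InH10Rod (Q : Set (Cross n)) (ε : ℝ) (v : Space n → ℝ) (g : Space n → Space n) : Prop :=
  HasWeakGrad (rod Q ε) v g ∧
    InSobolevVanishing (volume.restrict (rod Q ε)) (rodEnds Q ε) v g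

/-- The measure `μ_ε`: the Lebesgue measure restricted to the rescaled rod `ε^{-1/4} G_ε`, times
`ε^{-3(d-1)/4} / |Q|`. -/
def rodMeasure (Q : Set (Cross n)) (ε : ℝ) : Measure (Space n) :=
  ENNReal.ofReal (ε ^ (-(3 / 4 * n) : ℝ) / volume.real Q) •
    volume.restrict (ε ^ (-(1 / 4) : ℝ) • rod Q ε)

end

end ThinRod

open ThinRod

/-!
The difference of the two integrals is `∫ ρ v²` over the rod, where `ρ(x) = (χ w)(x₁, x/ε) - m(x₁)`
and `m(s)` is the mean of `(χ w)(s, ·)` over the periodicity cell. The rod consists of `2N + 1` cells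
of size `ε`, and the estimate is proved on each of them for `u = φ²` with `φ` smooth.

* On a cell, `u` is split into its mean and its oscillation. The oscillation is bounded by
  `C ε ∫ |∇u| ≤ 2 C ε ∫ |φ| |∇φ|` through the `L¹` Poincaré inequality on the cell
  (`oscillationBound_self`). That inequality follows from the fundamental theorem of calculus along
  segments: near each point of its closure a Lipschitz domain is star-shaped with respect to a ball
  (`HasInteriorCones`), and connectedness and compactness chain these local bounds together. No
  regularity of a corrector is needed, only boundedness of `ρ`.
* The mean of `u` is multiplied by `∫ ρ` over the cell, which would vanish if the slow variable were
  frozen there. It is of relative size `ε`, since `s ↦ (χ w)(s, ·)` is Lipschitz with values in `L¹`: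
  `w` is Lipschitz in `s`, and `χ` changes only where `|F(t, ·)| ≤ C ε`. The measure of this strip is
  of order `ε` (`exists_measure_strip_le`), because locally `F` is strictly monotone in some direction
  `h`, up to the boundary, so that a piece of the strip is disjoint from its translates by more than
  a multiple of `ε` along `h`.

Summing over the cells gives `C ε (∫ |φ| |∇φ| + ∫ φ²)`. As `φ` vanishes on the ends, Friedrichs'
inequality (`normL2_rod_le_normL2Vec_grad`) and the Cauchy–Schwarz inequality bound this by
`C ε ‖φ‖ ‖∇φ‖` (`IsSlowDensity.exists_abs_integral_rod_le`). Both sides are continuous in the `L²`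
norms of `v` and its gradient, which covers Sobolev functions. The second estimate is the first one
after the substitution `z = ε^(-1/4) x`.
-/

open MeasureTheory Set
open scoped Pointwise ContDiff

namespace ThinRod

/-! ### The `L¹` Poincaré inequality on domains with interior cones -/

section Poincare

variable {E : Type*} [NormedAddCommGroup E] [NormedSpace ℝ E]

/-- A uniform interior cone condition, required locally near each point `p` of the closure: from
every point of `P` close to `p` one can move along all multiples `t • v`, `0 < t ≤ 1`, of all
vectors `v` in one fixed ball without leaving `P`. -/
def HasInteriorCones (P : Set E) : Prop :=
  ∀ p ∈ closure P, ∃ r > 0, ∃ z : E, ∃ σ > 0, ∀ x ∈ P, dist x p < r →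
    ∀ v, dist v z < σ → ∀ t ∈ Ioc (0 : ℝ) 1, x + t • v ∈ P

variable [FiniteDimensional ℝ E] [MeasurableSpace E] [BorelSpace E]
  (μ : Measure E) [μ.IsAddHaarMeasure]

lemma lintegral_comp_smul_add_le {g : E → ENNReal} (hg : Measurable g) (c : E) {a : ℝ}
    (ha : 1 / 2 ≤ a) :
    ∫⁻ x, g (a • x + c) ∂μ ≤ 2 ^ Module.finrank ℝ E * ∫⁻ x, g x ∂μ := by
  have ha0 : a ≠ 0 := by linarith
  have h1 : ∫⁻ x, g (a • x + c) ∂μ = ∫⁻ x, g (x + c) ∂(Measure.map (a • ·) μ) :=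
    (lintegral_map (hg.comp (measurable_id.add_const c)) (measurable_const_smul a)).symm
  rw [h1, Measure.map_addHaar_smul μ ha0, lintegral_smul_measure,
    lintegral_add_right_eq_self g c, smul_eq_mul]
  gcongr
  rw [abs_of_pos (by positivity), ← inv_pow, ENNReal.ofReal_pow (by positivity)]
  gcongr
  rw [show (2 : ENNReal) = ENNReal.ofReal 2 by simp]
  apply ENNReal.ofReal_le_ofReal
  rw [inv_le_comm₀ (by linarith) (by norm_num)]
  linarith

/-- The oscillation of `C¹` functions between `A` and `B`, integrated over both sets, is controlled
by the `L¹` norm of their derivative on `P`. -/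
def OscillationBound (P A B : Set E) : Prop :=
  ∃ C : NNReal, ∀ u : E → ℝ, ContDiff ℝ 1 u →
    ∫⁻ x in A, ∫⁻ y in B, ‖u x - u y‖ₑ ∂μ ∂μ ≤ C * ∫⁻ x in P, ‖fderiv ℝ u x‖ₑ ∂μ

omit [FiniteDimensional ℝ E] [MeasurableSpace E] [BorelSpace E] in
lemma enorm_sub_le_lintegral_segment {P : Set E} {u : E → ℝ} (hu : ContDiff ℝ 1 u) {x y : E}
    (h : ∀ t ∈ Icc (0 : ℝ) 1, x + t • (y - x) ∈ P) :
    ‖u x - u y‖ₑ ≤ ∫⁻ t in Ioc (0 : ℝ) 1,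
      P.indicator (fun z => ‖fderiv ℝ u z‖ₑ) (x + t • (y - x)) * ‖y - x‖ₑ := by
  have hd : ∀ t : ℝ, HasDerivAt (fun t : ℝ => u (x + t • (y - x)))
      (fderiv ℝ u (x + t • (y - x)) (y - x)) t := by
    intro t
    have h1 : HasDerivAt (fun t : ℝ => x + t • (y - x)) (y - x) t := by
      simpa using ((hasDerivAt_id t).smul_const (y - x)).const_add x
    exact ((hu.differentiable one_ne_zero _).hasFDerivAt).comp_hasDerivAt t h1
  have hc : Continuous fun t : ℝ => fderiv ℝ u (x + t • (y - x)) (y - x) :=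
    ((hu.continuous_fderiv one_ne_zero).comp (by fun_prop)).clm_apply continuous_const
  have h2 := intervalIntegral.integral_eq_sub_of_hasDerivAt (a := 0) (b := 1)
    (fun t _ => hd t) (hc.intervalIntegrable 0 1)
  simp only [one_smul, zero_smul, add_zero, add_sub_cancel] at h2
  rw [← enorm_neg, neg_sub, ← h2, intervalIntegral.integral_of_le zero_le_one]
  refine (enorm_integral_le_lintegral_enorm _).trans ?_
  refine setLIntegral_mono' measurableSet_Ioc fun t ht => ?_
  rw [indicator_of_mem (h t ⟨ht.1.le, ht.2⟩)]
  exact ContinuousLinearMap.le_opENorm _ _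

variable {μ}

/-- Integrating the fundamental theorem of calculus along all segments from `A` to `B`: for each
parameter `t` at least one of the two maps `x ↦ (1 - t) x + t y` and `y ↦ (1 - t) x + t y`
contracts volumes by at most the factor `2⁻ᵈ`. -/
lemma OscillationBound.of_segments {P A B : Set E} (hP : MeasurableSet P) {R : ℝ}
    (hA : A ⊆ Metric.ball 0 R) (hB : B ⊆ Metric.ball 0 R)
    (hAm : MeasurableSet A) (hBm : MeasurableSet B)
    (h : ∀ x ∈ A, ∀ y ∈ B, ∀ t ∈ Icc (0 : ℝ) 1, x + t • (y - x) ∈ P) :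
    OscillationBound μ P A B := by
  set V := μ (Metric.ball (0 : E) R)
  have hV : V ≠ ⊤ := Metric.isBounded_ball.measure_lt_top.ne
  set D : ENNReal := ENNReal.ofReal (2 * R)
  have hCtop : D * (V * 2 ^ Module.finrank ℝ E) ≠ ⊤ :=
    ENNReal.mul_ne_top ENNReal.ofReal_ne_top
      (ENNReal.mul_ne_top hV (ENNReal.pow_ne_top (by norm_num)))
  refine ⟨(D * (V * 2 ^ Module.finrank ℝ E)).toNNReal, fun u hu => ?_⟩
  rw [ENNReal.coe_toNNReal hCtop]
  set g : E → ENNReal := P.indicator (fun z => ‖fderiv ℝ u z‖ₑ) with hg_def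
  have hg : Measurable g := (hu.continuous_fderiv one_ne_zero).enorm.measurable.indicator hP
  have hgI : ∫⁻ x, g x ∂μ = ∫⁻ x in P, ‖fderiv ℝ u x‖ₑ ∂μ := lintegral_indicator hP _
  rw [← hgI]
  have key : ∀ t ∈ Ioc (0 : ℝ) 1, ∫⁻ x in A, ∫⁻ y in B, g (x + t • (y - x)) ∂μ ∂μ ≤
      V * 2 ^ Module.finrank ℝ E * ∫⁻ x, g x ∂μ := by
    intro t ht
    have hm : Measurable fun p : E × E => g (p.1 + t • (p.2 - p.1)) := hg.comp (by fun_prop)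
    have hcst : ∀ S : Set E, S ⊆ Metric.ball 0 R →
        ∫⁻ _ in S, (2 ^ Module.finrank ℝ E * ∫⁻ x, g x ∂μ) ∂μ ≤
          V * 2 ^ Module.finrank ℝ E * ∫⁻ x, g x ∂μ := by
      intro S hS
      rw [lintegral_const, Measure.restrict_apply_univ, mul_comm, ← mul_assoc]
      gcongr
      exact measure_mono hS
    rcases le_total (1 / 2) t with h2 | h2
    · refine le_trans (lintegral_mono fun x => ?_) (hcst A hA)
      refine (setLIntegral_le_lintegral _ _).trans ?_
      have := lintegral_comp_smul_add_le μ hg ((1 - t) • x) h2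
      refine le_trans (le_of_eq ?_) this
      congr 1; ext y; congr 1
      rw [sub_smul, smul_sub, one_smul]; abel
    · rw [lintegral_lintegral_swap hm.aemeasurable]
      refine le_trans (lintegral_mono fun y => ?_) (hcst B hB)
      refine (setLIntegral_le_lintegral _ _).trans ?_
      have := lintegral_comp_smul_add_le μ hg (t • y) (a := 1 - t) (by linarith)
      refine le_trans (le_of_eq ?_) this
      congr 1; ext x; congr 1
      rw [sub_smul, smul_sub, one_smul]; abel
  have hm3 : Measurable fun p : (E × E) × ℝ => g (p.1.1 + p.2 • (p.1.2 - p.1.1)) :=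
    hg.comp (by fun_prop)
  calc ∫⁻ x in A, ∫⁻ y in B, ‖u x - u y‖ₑ ∂μ ∂μ
      ≤ ∫⁻ x in A, ∫⁻ y in B, D * (∫⁻ t in Ioc (0 : ℝ) 1, g (x + t • (y - x))) ∂μ ∂μ := by
        refine setLIntegral_mono' hAm fun x hx => setLIntegral_mono' hBm fun y hy => ?_
        refine (enorm_sub_le_lintegral_segment hu (h x hx y hy)).trans ?_
        rw [lintegral_mul_const' _ _ enorm_ne_top, mul_comm]
        gcongr
        rw [← ofReal_norm]
        apply ENNReal.ofReal_le_ofReal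
        have h1 := mem_ball_zero_iff.1 (hA hx)
        have h2 := mem_ball_zero_iff.1 (hB hy)
        linarith [norm_sub_le y x]
    _ = D * ∫⁻ t in Ioc (0 : ℝ) 1, ∫⁻ x in A, ∫⁻ y in B, g (x + t • (y - x)) ∂μ ∂μ := by
        simp_rw [lintegral_const_mul' D _ ENNReal.ofReal_ne_top]
        congr 1
        have : ∀ x, ∫⁻ y in B, (∫⁻ t in Ioc (0 : ℝ) 1, g (x + t • (y - x))) ∂μ =
            ∫⁻ t in Ioc (0 : ℝ) 1, ∫⁻ y in B, g (x + t • (y - x)) ∂μ := fun x => by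
          refine lintegral_lintegral_swap (Measurable.aemeasurable ?_)
          exact hg.comp (by fun_prop)
        simp_rw [this]
        refine lintegral_lintegral_swap (Measurable.aemeasurable ?_)
        refine Measurable.lintegral_prod_right' (f := fun p : (E × ℝ) × E =>
          g (p.1.1 + p.1.2 • (p.2 - p.1.1))) ?_
        exact hg.comp (by fun_prop)
    _ ≤ D * ∫⁻ _ in Ioc (0 : ℝ) 1, V * 2 ^ Module.finrank ℝ E * ∫⁻ x, g x ∂μ := by
        gcongr 1
        exact setLIntegral_mono' measurableSet_Ioc key
    _ = D * (V * 2 ^ Module.finrank ℝ E) * ∫⁻ x, g x ∂μ := by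
        simp [mul_assoc]

omit [FiniteDimensional ℝ E] [BorelSpace E] [μ.IsAddHaarMeasure] in
lemma OscillationBound.mono {P A A' B B' : Set E} (h : OscillationBound μ P A B)
    (hA : A' ⊆ A) (hB : B' ⊆ B) : OscillationBound μ P A' B' := by
  obtain ⟨C, hC⟩ := h
  refine ⟨C, fun u hu => le_trans ?_ (hC u hu)⟩
  refine (lintegral_mono_set hA).trans (lintegral_mono fun x => lintegral_mono_set hB)

lemma OscillationBound.symm {P A B : Set E} (h : OscillationBound μ P A B) :
    OscillationBound μ P B A := by
  obtain ⟨C, hC⟩ := h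
  refine ⟨C, fun u hu => le_trans (le_of_eq ?_) (hC u hu)⟩
  have hc := hu.continuous
  rw [lintegral_lintegral_swap]
  · refine lintegral_congr fun x => lintegral_congr fun y => ?_
    rw [← enorm_neg, neg_sub]
  · exact Continuous.aemeasurable (by fun_prop)

omit [FiniteDimensional ℝ E] [BorelSpace E] [μ.IsAddHaarMeasure] in
lemma OscillationBound.union {P A A' B : Set E} (h : OscillationBound μ P A B)
    (h' : OscillationBound μ P A' B) : OscillationBound μ P (A ∪ A') B := by
  obtain ⟨C, hC⟩ := h
  obtain ⟨C', hC'⟩ := h'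
  refine ⟨C + C', fun u hu => ?_⟩
  rw [ENNReal.coe_add, add_mul]
  exact (lintegral_union_le _ _ _).trans (add_le_add (hC u hu) (hC' u hu))

/-- Chaining through an intermediate set `B`: the triangle inequality is averaged over the
intermediate point in `B`, which is why `B` must not be a null set. -/
lemma OscillationBound.trans {P A B D : Set E} (h : OscillationBound μ P A B)
    (h' : OscillationBound μ P B D) (hA : μ A ≠ ⊤) (hD : μ D ≠ ⊤) (hB : μ B ≠ ⊤)
    (hB0 : μ B ≠ 0) : OscillationBound μ P A D := by
  obtain ⟨C, hC⟩ := h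
  obtain ⟨C', hC'⟩ := h'
  refine ⟨((μ B)⁻¹ * (μ D * C + μ A * C')).toNNReal, fun u hu => ?_⟩
  rw [ENNReal.coe_toNNReal (by finiteness)]
  have hc := hu.continuous
  set G := ∫⁻ x in P, ‖fderiv ℝ u x‖ₑ ∂μ
  rw [mul_assoc, ← ENNReal.mul_le_iff_le_inv hB0 hB]
  calc μ B * ∫⁻ x in A, ∫⁻ z in D, ‖u x - u z‖ₑ ∂μ ∂μ
      = ∫⁻ x in A, ∫⁻ z in D, ∫⁻ y in B, ‖u x - u z‖ₑ ∂μ ∂μ ∂μ := by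
        simp_rw [lintegral_const, Measure.restrict_apply_univ, mul_comm _ (μ B),
          lintegral_const_mul' _ _ hB]
    _ ≤ ∫⁻ x in A, ∫⁻ z in D, (∫⁻ y in B, ‖u x - u y‖ₑ ∂μ + ∫⁻ y in B, ‖u y - u z‖ₑ ∂μ) ∂μ ∂μ := by
        refine lintegral_mono fun x => lintegral_mono fun z => ?_
        rw [← lintegral_add_left (by fun_prop)]
        refine lintegral_mono fun y => ?_
        rw [← sub_add_sub_cancel (u x) (u y) (u z)]
        exact enorm_add_le _ _
    _ = ∫⁻ x in A, (μ D * ∫⁻ y in B, ‖u x - u y‖ₑ ∂μ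
          + ∫⁻ z in D, ∫⁻ y in B, ‖u y - u z‖ₑ ∂μ ∂μ) ∂μ := by
        congr 1; ext x
        rw [lintegral_add_left measurable_const, lintegral_const, Measure.restrict_apply_univ,
          mul_comm]
    _ = μ D * (∫⁻ x in A, ∫⁻ y in B, ‖u x - u y‖ₑ ∂μ ∂μ)
          + μ A * ∫⁻ y in B, ∫⁻ z in D, ‖u y - u z‖ₑ ∂μ ∂μ := by
        rw [lintegral_add_right _ measurable_const, lintegral_const, Measure.restrict_apply_univ,
          lintegral_const_mul' _ _ hD, mul_comm (μ A)]
        congr 2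
        exact lintegral_lintegral_swap (Continuous.aemeasurable (by fun_prop))
    _ ≤ μ D * (C * G) + μ A * (C' * G) := by
        gcongr
        · exact hC u hu
        · exact hC' u hu
    _ = (μ D * C + μ A * C') * G := by ring

lemma OscillationBound.of_convex {P S : Set E} (hP : MeasurableSet P) (hS : Convex ℝ S)
    (hSP : S ⊆ P) (hSb : Bornology.IsBounded S) (hSm : MeasurableSet S) :
    OscillationBound μ P S S := by
  obtain ⟨R, hR⟩ := hSb.subset_ball 0
  refine .of_segments hP hR hR hSm hSm fun x hx y hy t ht => hSP ?_
  exact hS.add_smul_sub_mem hx hy ht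

omit [NormedSpace ℝ E] [FiniteDimensional ℝ E] [BorelSpace E] in
lemma measure_ball_ne_zero_of_pos (p : E) {r : ℝ} (hr : 0 < r) : μ (Metric.ball p r) ≠ 0 :=
  (Metric.measure_ball_pos μ p hr).ne'

/-- Connectedness propagates the oscillation bound from one ball to a neighbourhood of every point
of `P`. -/
lemma oscillationBound_ball_of_isConnected {P : Set E} (hPo : IsOpen P) (hPc : IsPreconnected P)
    {x₀ : E} {r₀ : ℝ} (hr₀ : 0 < r₀) (hB : Metric.ball x₀ r₀ ⊆ P) :
    ∀ p ∈ P, ∃ r > 0, Metric.ball p r ⊆ P ∧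
      OscillationBound μ P (Metric.ball p r) (Metric.ball x₀ r₀) := by
  set S : Set E := {p | ∃ r > 0, Metric.ball p r ⊆ P ∧
      OscillationBound μ P (Metric.ball p r) (Metric.ball x₀ r₀)}
  have hfin : ∀ (p : E) (r : ℝ), μ (Metric.ball p r) ≠ ⊤ := fun p r =>
    Metric.isBounded_ball.measure_lt_top.ne
  have hconv : ∀ (p : E) (r : ℝ), Metric.ball p r ⊆ P →
      OscillationBound μ P (Metric.ball p r) (Metric.ball p r) := fun p r h =>
    .of_convex hPo.measurableSet (convex_ball p r) h Metric.isBounded_ball measurableSet_ball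
  have hSo : IsOpen S := by
    rw [Metric.isOpen_iff]
    rintro p ⟨r, hr, hrP, ho⟩
    refine ⟨r / 2, by positivity, fun q hq => ⟨r / 2, by positivity, ?_⟩⟩
    have hsub : Metric.ball q (r / 2) ⊆ Metric.ball p r :=
      Metric.ball_subset_ball' (by linarith [Metric.mem_ball.1 hq])
    exact ⟨hsub.trans hrP, ho.mono hsub subset_rfl⟩
  have hx₀ : x₀ ∈ S := ⟨r₀, hr₀, hB, hconv _ _ hB⟩
  refine hPc.subset_of_closure_inter_subset hSo ⟨x₀, hB (Metric.mem_ball_self hr₀), hx₀⟩ ?_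
  rintro p ⟨hpS, hpP⟩
  obtain ⟨r, hr, hrP⟩ := Metric.isOpen_iff.1 hPo p hpP
  obtain ⟨q, ⟨r', hr', hr'P, ho⟩, hq⟩ := Metric.mem_closure_iff.1 hpS r hr
  obtain ⟨s, hs, hsub⟩ := Metric.isOpen_iff.1
    (Metric.isOpen_ball.inter Metric.isOpen_ball : IsOpen (Metric.ball p r ∩ Metric.ball q r')) q
    ⟨by rwa [Metric.mem_ball, dist_comm], Metric.mem_ball_self hr'⟩
  refine ⟨r, hr, hrP, ?_⟩
  exact ((hconv p r hrP).mono subset_rfl (hsub.trans inter_subset_left)).trans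
    (ho.mono (hsub.trans inter_subset_right) subset_rfl) (hfin _ _) (hfin _ _) (hfin _ _)
    (measure_ball_ne_zero_of_pos q hs)

/-- The `L¹` Poincaré inequality on a bounded connected open set with interior cones. -/
theorem oscillationBound_self {P : Set E} (hPo : IsOpen P) (hPc : IsConnected P)
    (hPb : Bornology.IsBounded P) (hcone : HasInteriorCones P) : OscillationBound μ P P P := by
  obtain ⟨x₀, hx₀⟩ := hPc.nonempty
  obtain ⟨r₀, hr₀, hB⟩ := Metric.isOpen_iff.1 hPo x₀ hx₀
  have hfin : ∀ S : Set E, Bornology.IsBounded S → μ S ≠ ⊤ := fun S hS => hS.measure_lt_top.ne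
  have hball := oscillationBound_ball_of_isConnected (μ := μ) hPo hPc.isPreconnected hr₀ hB
  have hloc : ∀ p ∈ closure P, ∃ r > 0,
      OscillationBound μ P (P ∩ Metric.ball p r) (Metric.ball x₀ r₀) := by
    intro p hp
    obtain ⟨r, hr, z, σ, hσ, hc⟩ := hcone p hp
    have hr' : 0 < min r (σ / 2) := by positivity
    -- Near `p` the set `P` is star-shaped with respect to the ball of radius `σ / 2` about `p + z`.
    obtain ⟨R, hR⟩ := hPb.subset_ball 0
    have hmem : ∀ x ∈ P ∩ Metric.ball p (min r (σ / 2)), ∀ y ∈ Metric.ball (p + z) (σ / 2),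
        ∀ t ∈ Icc (0 : ℝ) 1, x + t • (y - x) ∈ P := by
      intro x hx y hy t ht
      rcases ht.1.eq_or_lt with rfl | ht0
      · simpa using hx.1
      · refine hc x hx.1 ((Metric.mem_ball.1 hx.2).trans_le (min_le_left _ _)) _ ?_ t ⟨ht0, ht.2⟩
        have h1 := (Metric.mem_ball.1 hx.2).trans_le (min_le_right _ _)
        have h2 := Metric.mem_ball.1 hy
        rw [dist_eq_norm] at h1 h2 ⊢
        calc ‖y - x - z‖ = ‖(y - (p + z)) - (x - p)‖ := by congr 1; abel
          _ ≤ ‖y - (p + z)‖ + ‖x - p‖ := norm_sub_le _ _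
          _ < σ := by linarith
    obtain ⟨x, hxP, hx⟩ := Metric.mem_closure_iff.1 hp _ hr'
    have hsubP : Metric.ball (p + z) (σ / 2) ⊆ P := fun y hy => by
      simpa using hmem x ⟨hxP, by rwa [Metric.mem_ball, dist_comm]⟩ y hy 1 ⟨zero_le_one, le_rfl⟩
    have ho : OscillationBound μ P (P ∩ Metric.ball p (min r (σ / 2)))
        (Metric.ball (p + z) (σ / 2)) :=
      .of_segments hPo.measurableSet (inter_subset_left.trans hR) (hsubP.trans hR)
        (hPo.measurableSet.inter measurableSet_ball) measurableSet_ball hmem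
    obtain ⟨s, hs, hsP, hos⟩ := hball (p + z) (hsubP (Metric.mem_ball_self (by positivity)))
    have hs' : 0 < min s (σ / 2) := by positivity
    refine ⟨_, hr', ?_⟩
    exact (ho.mono subset_rfl (Metric.ball_subset_ball (min_le_right s _))).trans
      (hos.mono (Metric.ball_subset_ball (min_le_left _ (σ / 2))) subset_rfl)
      (hfin _ (hPb.subset inter_subset_left)) (hfin _ Metric.isBounded_ball)
      (hfin _ Metric.isBounded_ball) (measure_ball_ne_zero_of_pos _ hs')
  choose! r hr hor using hloc
  obtain ⟨T, hT, hcov⟩ := hPb.isCompact_closure.elim_nhds_subcover (fun p => Metric.ball p (r p))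
    (fun p hp => Metric.ball_mem_nhds p (hr p hp))
  have hfinite : ∀ T' : Finset E, (∀ p ∈ T', p ∈ closure P) →
      OscillationBound μ P (⋃ p ∈ T', P ∩ Metric.ball p (r p)) (Metric.ball x₀ r₀) := by
    classical
    intro T'
    induction T' using Finset.induction_on with
    | empty => intro _; exact ⟨0, fun u _ => by simp⟩
    | insert a s ha ih =>
      intro h
      rw [Finset.set_biUnion_insert]
      exact (hor a (h a (by simp))).union (ih fun p hp => h p (by simp [hp]))
  have hPball : OscillationBound μ P P (Metric.ball x₀ r₀) := by
    refine (hfinite T hT).mono (fun x hx => ?_) subset_rfl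
    have := hcov (subset_closure hx)
    simp only [mem_iUnion, exists_prop] at this ⊢
    obtain ⟨p, hp, hxp⟩ := this
    exact ⟨p, hp, hx, hxp⟩
  exact hPball.trans hPball.symm (hfin _ hPb) (hfin _ hPb) (hfin _ Metric.isBounded_ball)
    (measure_ball_ne_zero_of_pos _ hr₀)

end Poincare

/-! ### Measure of level strips up to a Lipschitz boundary -/

section Strip

variable {E : Type*} [NormedAddCommGroup E] [NormedSpace ℝ E]

/-- If a set is disjoint from all its translates by `s • h`, `s ≥ τ`, then about `1 / τ` disjoint
copies of it fit into a bounded region, so that its measure is of order `τ`. -/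
lemma measure_le_of_disjoint_translates [MeasurableSpace E] [BorelSpace E] {μ : Measure E}
    [μ.IsAddRightInvariant] {A : Set E} (hA : MeasurableSet A) {R : ℝ}
    (hAR : A ⊆ Metric.ball 0 R) (h : E) {τ : ℝ} (hτ : 0 < τ)
    (hd : ∀ s, τ ≤ s → ∀ x ∈ A, x + s • h ∉ A) :
    μ A ≤ ENNReal.ofReal τ * μ (Metric.ball 0 (R + ‖h‖)) := by
  rcases le_total τ 1 with h1 | h1
  · set m := ⌊1 / τ⌋₊
    have hmτ : (m : ℝ) * τ ≤ 1 := by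
      have := Nat.floor_le (show (0 : ℝ) ≤ 1 / τ by positivity)
      rwa [le_div_iff₀ hτ] at this
    have hm1 : 1 ≤ ((m + 1 : ℕ) : ℝ) * τ := by
      have := (Nat.lt_floor_add_one (1 / τ)).le
      rw [div_le_iff₀ hτ] at this
      exact_mod_cast this
    set B : ℕ → Set E := fun i => (fun x => x + ((i : ℝ) * τ) • h) ⁻¹' A
    have hBm : ∀ i, MeasurableSet (B i) := fun i => (measurable_id.add_const _) hA
    have hBμ : ∀ i, μ (B i) = μ A := fun i => measure_preimage_add_right μ _ A
    have hlt : ∀ i j, i < j → Disjoint (B i) (B j) := by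
      intro i j hij
      rw [Set.disjoint_left]
      intro x hx hx'
      refine hd (((j : ℝ) - i) * τ) ?_ _ hx ?_
      · have : (1 : ℝ) ≤ (j : ℝ) - i := by
          have : ((i + 1 : ℕ) : ℝ) ≤ j := by exact_mod_cast hij
          push_cast at this; linarith
        nlinarith
      · have : x + ((i : ℝ) * τ) • h + (((j : ℝ) - i) * τ) • h = x + ((j : ℝ) * τ) • h := by
          rw [add_assoc, ← add_smul]; congr 2; ring
        rw [this]
        exact hx'
    have hdisj : Pairwise (Function.onFun Disjoint B) := by
      intro i j hij
      rcases lt_or_gt_of_ne hij with h | h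
      · exact hlt i j h
      · exact (hlt j i h).symm
    have hsum : ((m + 1 : ℕ) : ENNReal) * μ A ≤ μ (Metric.ball 0 (R + ‖h‖)) := by
      have h2 : μ (⋃ i ∈ Finset.range (m + 1), B i) = ∑ i ∈ Finset.range (m + 1), μ (B i) :=
        measure_biUnion_finset (fun i _ j _ hij => hdisj hij) fun i _ => hBm i
      simp only [hBμ, Finset.sum_const, Finset.card_range, nsmul_eq_mul] at h2
      rw [← h2]
      refine measure_mono (iUnion₂_subset fun i hi x hx => ?_)
      have hx1 := mem_ball_zero_iff.1 (hAR hx)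
      rw [mem_ball_zero_iff]
      have hi' : (i : ℝ) * τ ≤ 1 := by
        have : (i : ℝ) ≤ m := by exact_mod_cast Nat.lt_succ_iff.1 (Finset.mem_range.1 hi)
        nlinarith
      have hn : ‖((i : ℝ) * τ) • h‖ ≤ ‖h‖ := by
        rw [norm_smul, Real.norm_of_nonneg (by positivity)]
        nlinarith [norm_nonneg h]
      calc ‖x‖ = ‖(x + ((i : ℝ) * τ) • h) - ((i : ℝ) * τ) • h‖ := by rw [add_sub_cancel_right]
        _ ≤ _ := norm_sub_le _ _
        _ < _ := by linarith
    calc μ A = 1 * μ A := (one_mul _).symm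
      _ ≤ ENNReal.ofReal (τ * (m + 1 : ℕ)) * μ A := by
          gcongr
          rw [ENNReal.one_le_ofReal, mul_comm]
          exact hm1
      _ = ENNReal.ofReal τ * (((m + 1 : ℕ) : ENNReal) * μ A) := by
          rw [ENNReal.ofReal_mul hτ.le, ENNReal.ofReal_natCast, mul_assoc]
      _ ≤ _ := by gcongr
  · calc μ A = 1 * μ A := (one_mul _).symm
      _ ≤ _ := by
        gcongr
        · rwa [ENNReal.one_le_ofReal]
        · exact hAR.trans (Metric.ball_subset_ball (by linarith [norm_nonneg h]))

/-- Strict differentiability up to the boundary: interior cones join two points of `P` near `p` by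
two segments in `P` whose lengths are comparable to the distance of the points, so that continuity
of the derivative at the boundary point `p` controls increments of the function near `p`. -/
lemma exists_forall_abs_sub_sub_le {P : Set E} (hcone : HasInteriorCones P) {p : E}
    (hp : p ∈ closure P) {f : E → ℝ} {f' : E → E →L[ℝ] ℝ} (hf : ∀ x ∈ P, HasFDerivAt f (f' x) x)
    {A : E →L[ℝ] ℝ} (hA : ∀ η > 0, ∃ ρ > 0, ∀ x ∈ P, dist x p < ρ → ‖f' x - A‖ ≤ η)
    {η : ℝ} (hη : 0 < η) :
    ∃ ρ > 0, ∀ x ∈ P, ∀ x' ∈ P, dist x p < ρ → dist x' p < ρ →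
      |f x' - f x - A (x' - x)| ≤ η * ‖x' - x‖ := by
  obtain ⟨r, hr, z, σ, hσ, hc⟩ := hcone p hp
  set M : ℝ := 1 + 4 * ‖z‖ / σ with hM
  have hM0 : 0 < M := by positivity
  obtain ⟨ρ₀, hρ₀, hA⟩ := hA (η / M) (by positivity)
  have hseg : ∀ x v, dist x p + ‖v‖ < ρ₀ → (∀ s ∈ Icc (0 : ℝ) 1, x + s • v ∈ P) →
      |f (x + v) - f x - A v| ≤ η / M * ‖v‖ := by
    intro x v hxv hP
    have hsP : ∀ y ∈ segment ℝ x (x + v), y ∈ P ∧ dist y p < ρ₀ := by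
      intro y hy
      rw [segment_eq_image'] at hy
      obtain ⟨s, hs, rfl⟩ := hy
      simp only [add_sub_cancel_left]
      refine ⟨hP s hs, lt_of_le_of_lt ?_ hxv⟩
      calc dist (x + s • v) p ≤ dist (x + s • v) x + dist x p := dist_triangle _ _ _
        _ ≤ ‖v‖ + dist x p := by
          gcongr
          rw [dist_eq_norm, add_sub_cancel_left, norm_smul, Real.norm_of_nonneg hs.1]
          nlinarith [norm_nonneg v, hs.2]
        _ = _ := add_comm _ _
    have := (convex_segment x (x + v)).norm_image_sub_le_of_norm_hasFDerivWithin_le' (f := f)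
      (f' := f') (φ := A) (C := η / M) (fun y hy => (hf y (hsP y hy).1).hasFDerivWithinAt)
      (fun y hy => hA y (hsP y hy).1 (hsP y hy).2) (left_mem_segment ℝ _ _)
      (right_mem_segment ℝ _ _)
    simpa only [add_sub_cancel_left, Real.norm_eq_abs] using this
  -- The bound `σ / 4` makes the step `t = 2 d / σ` below at most `1`; the last bound keeps both
  -- segments inside the ball of radius `ρ₀`.
  refine ⟨min r (min (σ / 4) (ρ₀ / (1 + 2 * M))), by positivity, fun x hx x' hx' hxp hx'p => ?_⟩
  simp only [lt_min_iff] at hxp hx'p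
  set d := ‖x' - x‖ with hd
  rcases eq_or_ne x x' with rfl | hne
  · simp [hd]
  have hd0 : 0 < d := norm_pos_iff.2 (sub_ne_zero.2 hne.symm)
  have hd2 : d ≤ dist x p + dist x' p := by
    rw [hd, ← dist_eq_norm, add_comm]; exact dist_triangle_right _ _ _
  set t := 2 * d / σ with ht
  have ht0 : 0 < t := by positivity
  have ht1 : t ≤ 1 := by rw [ht, div_le_one hσ]; linarith
  have htz : t * ‖z‖ + (d + t * ‖z‖) = M * d := by rw [ht, hM]; field_simp; ring
  have hρ : ∀ q, dist q p < ρ₀ / (1 + 2 * M) → dist q p + M * d < ρ₀ := by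
    intro q hq
    have h1 : d < 2 * (ρ₀ / (1 + 2 * M)) := by linarith
    calc dist q p + M * d < ρ₀ / (1 + 2 * M) + M * (2 * (ρ₀ / (1 + 2 * M))) :=
          add_lt_add hq (by gcongr)
      _ = ρ₀ := by field_simp
  -- Both points are joined to the common point `x + t • z`, which lies in both cones.
  have hstep : ∀ s ∈ Icc (0 : ℝ) 1, s = 0 ∨ s * t ∈ Ioc (0 : ℝ) 1 := by
    intro s hs
    rcases hs.1.eq_or_lt with h | h
    · exact Or.inl h.symm
    · exact Or.inr ⟨by positivity, by nlinarith [hs.2]⟩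
  have h1 : |f (x + t • z) - f x - A (t • z)| ≤ η / M * (t * ‖z‖) := by
    have := hseg x (t • z) ?_ ?_
    · rwa [norm_smul, Real.norm_of_nonneg ht0.le] at this
    · rw [norm_smul, Real.norm_of_nonneg ht0.le]
      have h3 : 0 ≤ d + t * ‖z‖ := by positivity
      linarith [hρ x hxp.2.2]
    · intro s hs
      rcases hstep s hs with rfl | h
      · simpa using hx
      · rw [smul_smul]; exact hc x hx hxp.1 z (by simpa using hσ) _ h
  have hn2 : ‖x - x' + t • z‖ ≤ d + t * ‖z‖ := by
    refine (norm_add_le _ _).trans ?_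
    rw [norm_smul, Real.norm_of_nonneg ht0.le, norm_sub_rev]
  have h2 : |f (x + t • z) - f x' - A (x - x' + t • z)| ≤ η / M * (d + t * ‖z‖) := by
    have := hseg x' (x - x' + t • z) ?_ ?_
    · rw [show x' + (x - x' + t • z) = x + t • z by abel] at this
      exact this.trans (by gcongr)
    · have h3 : 0 ≤ t * ‖z‖ := by positivity
      linarith [hρ x' hx'p.2.2]
    · intro s hs
      rcases hstep s hs with rfl | h
      · simpa using hx'
      · have hv : s • (x - x' + t • z) = (s * t) • (z + t⁻¹ • (x - x')) := by
          rw [smul_add, smul_add, smul_smul, smul_smul, mul_assoc, mul_inv_cancel₀ ht0.ne',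
            mul_one, add_comm]
        rw [hv]
        refine hc x' hx' hx'p.1 _ ?_ _ h
        rw [dist_eq_norm, add_sub_cancel_left, norm_smul, norm_inv,
          Real.norm_of_nonneg ht0.le, norm_sub_rev, ← hd, ht]
        have : (2 * d / σ)⁻¹ * d = σ / 2 := by field_simp
        rw [this]; linarith
  have h3 : f x' - f x - A (x' - x) = (f (x + t • z) - f x - A (t • z)) -
      (f (x + t • z) - f x' - A (x - x' + t • z)) := by
    simp only [map_sub, map_add]; ring
  rw [h3]
  calc _ ≤ _ := abs_sub _ _
    _ ≤ η / M * (t * ‖z‖) + η / M * (d + t * ‖z‖) := add_le_add h1 h2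
    _ = η / M * (M * d) := by rw [← htz]; ring
    _ = η * d := by field_simp

variable [MeasurableSpace E] [BorelSpace E] [FiniteDimensional ℝ E] {μ : Measure E}
  [μ.IsAddHaarMeasure]

/-- Near a point where the derivative in some direction `h` along the slice does not vanish, `f` is
strictly monotone in the direction `h`, up to the boundary. Hence the strip `{|f(t, ·)| ≤ δ}` is
disjoint from its translates along `h` by more than a multiple of `δ`. -/
lemma exists_measure_strip_le_of_deriv_ne_zero {J : Set ℝ} {P : Set E} (hP : MeasurableSet P)
    (hPb : Bornology.IsBounded P) (hcone : HasInteriorCones (J ×ˢ P)) {p : ℝ × E}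
    (hp : p ∈ closure (J ×ˢ P)) {f : ℝ × E → ℝ} {f' : ℝ × E → ℝ × E →L[ℝ] ℝ}
    (hf : ∀ x ∈ J ×ˢ P, HasFDerivAt f (f' x) x) {A : ℝ × E →L[ℝ] ℝ}
    (hA : ∀ η > 0, ∃ ρ > 0, ∀ x ∈ J ×ˢ P, dist x p < ρ → ‖f' x - A‖ ≤ η)
    {h : E} (hh : A (0, h) ≠ 0) :
    ∃ ρ > 0, ∃ C : NNReal, ∀ t ∈ J, ∀ δ > 0,
      μ {y ∈ P | dist (t, y) p < ρ ∧ |f (t, y)| ≤ δ} ≤ ENNReal.ofReal δ * C := by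
  set c := |A (0, h)|
  have hc : 0 < c := abs_pos.2 hh
  have hh0 : h ≠ 0 := by
    rintro rfl; exact hh (by rw [← Prod.zero_eq_mk, map_zero])
  have hhn : 0 < ‖h‖ := norm_pos_iff.2 hh0
  obtain ⟨ρ, hρ, hT⟩ := exists_forall_abs_sub_sub_le hcone hp hf hA
    (η := c / (2 * ‖h‖)) (by positivity)
  obtain ⟨R, hR⟩ := hPb.subset_ball 0
  set V := μ (Metric.ball (0 : E) (R + ‖h‖))
  have hV : V ≠ ⊤ := Metric.isBounded_ball.measure_lt_top.ne
  have hCtop : ENNReal.ofReal (8 / c) * V ≠ ⊤ := by finiteness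
  refine ⟨ρ, hρ, (ENNReal.ofReal (8 / c) * V).toNNReal, fun t ht δ hδ => ?_⟩
  rw [ENNReal.coe_toNNReal hCtop, ← mul_assoc, ← ENNReal.ofReal_mul hδ.le]
  have hfc : ContinuousOn (fun y => |f (t, y)|) P := fun y hy =>
    (((hf (t, y) ⟨ht, hy⟩).continuousAt.comp (f := fun y : E => (t, y))
      (by fun_prop)).abs).continuousWithinAt
  have hm : MeasurableSet {y ∈ P | dist (t, y) p < ρ ∧ |f (t, y)| ≤ δ} := by
    have h1 : MeasurableSet (P ∩ (fun y => |f (t, y)|) ⁻¹' Iic δ) := by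
      obtain ⟨u, hu, hu'⟩ := continuousOn_iff_isClosed.1 hfc (Iic δ) isClosed_Iic
      rw [inter_comm, hu']
      exact hu.measurableSet.inter hP
    have h2 : MeasurableSet {y : E | dist (t, y) p < ρ} :=
      (isOpen_lt (by fun_prop) continuous_const).measurableSet
    convert h1.inter h2 using 1
    ext y; simp only [mem_ofPred_eq, mem_inter_iff, mem_preimage, mem_Iic]; tauto
  refine measure_le_of_disjoint_translates hm ((sep_subset _ _).trans hR) h (by positivity) ?_
  rintro s hs y ⟨hy, hyρ, hyδ⟩ ⟨hy', hyρ', hyδ'⟩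
  have hs0 : 0 < s := lt_of_lt_of_le (by positivity) hs
  -- Between the two points `f` changes by at least `s * c / 2`, but by at most `2 * δ`, which is
  -- impossible for `s ≥ 8 * δ / c`.
  have h1 := hT (t, y) ⟨ht, hy⟩ (t, y + s • h) ⟨ht, hy'⟩ hyρ hyρ'
  have h2 : ((t, y + s • h) : ℝ × E) - (t, y) = s • (0, h) := by ext <;> simp
  have h3 : ‖((0, h) : ℝ × E)‖ = ‖h‖ := by simp [Prod.norm_def]
  rw [h2, map_smul, norm_smul, Real.norm_of_nonneg hs0.le, h3, smul_eq_mul] at h1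
  have h4 : c / (2 * ‖h‖) * (s * ‖h‖) = s * c / 2 := by field_simp
  have h5 : s * c = |s * A (0, h)| := by rw [abs_mul, abs_of_pos hs0]
  have h6 : s * c ≤ s * c / 2 + 2 * δ := by
    rw [← h4]
    nth_rw 1 [h5]
    calc |s * A (0, h)| = |f (t, y + s • h) - f (t, y) -
          (f (t, y + s • h) - f (t, y) - s * A (0, h))| := by congr 1; ring
      _ ≤ |f (t, y + s • h) - f (t, y)| + _ := abs_sub _ _
      _ ≤ (δ + δ) + c / (2 * ‖h‖) * (s * ‖h‖) :=
        add_le_add ((abs_sub _ _).trans (add_le_add hyδ' hyδ)) h1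
      _ = _ := by ring
  have h7 : δ * (8 / c) * c = 8 * δ := by field_simp
  nlinarith

/-- Uniform bound for the measure of the strips `{|f(t, ·)| ≤ δ}`, obtained from a finite cover of
the closure by neighbourhoods on which either a directional derivative of `f` along the slices or
`f` itself stays away from zero. -/
theorem exists_measure_strip_le {J : Set ℝ} {P : Set E} (hP : MeasurableSet P)
    (hPb : Bornology.IsBounded P) (hJb : Bornology.IsBounded J)
    (hcone : HasInteriorCones (J ×ˢ P)) {f : ℝ × E → ℝ} {f' : ℝ × E → ℝ × E →L[ℝ] ℝ}
    (hf : ∀ x ∈ J ×ˢ P, HasFDerivAt f (f' x) x)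
    (hA : ∀ p ∈ closure (J ×ˢ P), ∀ η > 0, ∃ ρ > 0, ∀ x ∈ J ×ˢ P, dist x p < ρ →
      ‖f' x - f' p‖ ≤ η)
    (hne : ∀ p ∈ closure (J ×ˢ P), (∃ h, f' p (0, h) ≠ 0) ∨
      ∃ ρ > 0, ∃ c > 0, ∀ x ∈ J ×ˢ P, dist x p < ρ → c ≤ |f x|) :
    ∃ C : NNReal, ∀ t ∈ J, ∀ δ > 0, μ {y ∈ P | |f (t, y)| ≤ δ} ≤ ENNReal.ofReal δ * C := by
  have hloc : ∀ p ∈ closure (J ×ˢ P), ∃ ρ > 0, ∃ C : NNReal, ∀ t ∈ J, ∀ δ > 0,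
      μ {y ∈ P | dist (t, y) p < ρ ∧ |f (t, y)| ≤ δ} ≤ ENNReal.ofReal δ * C := by
    intro p hp
    rcases hne p hp with ⟨h, hh⟩ | ⟨ρ, hρ, c, hc, hlow⟩
    · exact exists_measure_strip_le_of_deriv_ne_zero hP hPb hcone hp hf (hA p hp) hh
    · have hPt : μ P ≠ ⊤ := hPb.measure_lt_top.ne
      have hCtop : ENNReal.ofReal c⁻¹ * μ P ≠ ⊤ := by finiteness
      refine ⟨ρ, hρ, (ENNReal.ofReal c⁻¹ * μ P).toNNReal, fun t ht δ hδ => ?_⟩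
      rw [ENNReal.coe_toNNReal hCtop]
      rcases lt_or_ge δ c with hlt | hge
      · have : {y ∈ P | dist (t, y) p < ρ ∧ |f (t, y)| ≤ δ} = ∅ := by
          ext y
          simp only [mem_ofPred_eq, mem_empty_iff_false, iff_false]
          rintro ⟨hy, hd, hle⟩
          linarith [hlow (t, y) ⟨ht, hy⟩ hd]
        simp [this]
      · rw [← mul_assoc, ← ENNReal.ofReal_mul hδ.le]
        calc _ ≤ μ P := measure_mono (sep_subset _ _)
          _ = 1 * μ P := (one_mul _).symm
          _ ≤ _ := by
            gcongr
            rw [ENNReal.one_le_ofReal, ← div_eq_mul_inv]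
            exact (one_le_div hc).2 hge
  choose! ρ hρ C hC using hloc
  obtain ⟨T, hT, hcov⟩ := (hJb.prod hPb).isCompact_closure.elim_nhds_subcover
    (fun p => Metric.ball p (ρ p)) (fun p hp => Metric.ball_mem_nhds p (hρ p hp))
  refine ⟨∑ p ∈ T, C p, fun t ht δ hδ => ?_⟩
  calc μ {y ∈ P | |f (t, y)| ≤ δ}
      ≤ μ (⋃ p ∈ T, {y ∈ P | dist (t, y) p < ρ p ∧ |f (t, y)| ≤ δ}) := by
        refine measure_mono fun y hy => ?_
        have := hcov (subset_closure (show (t, y) ∈ J ×ˢ P from ⟨ht, hy.1⟩))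
        simp only [mem_iUnion, exists_prop] at this ⊢
        obtain ⟨p, hp, hyp⟩ := this
        exact ⟨p, hp, hy.1, hyp, hy.2⟩
    _ ≤ ∑ p ∈ T, μ {y ∈ P | dist (t, y) p < ρ p ∧ |f (t, y)| ≤ δ} :=
        measure_biUnion_finset_le _ _
    _ ≤ ∑ p ∈ T, ENNReal.ofReal δ * C p := Finset.sum_le_sum fun p hp => hC p (hT p hp) t ht δ hδ
    _ = _ := by rw [← Finset.mul_sum]; push_cast; rfl

end Strip

/-! ### The perforated cell and its dependence on the slow variable -/

section Geometry

variable {n : ℕ}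

/-- The open cell `(-1/2, 1/2) × Q`, which differs from `cell Q` by a null set. -/
abbrev openCell (Q : Set (Cross n)) : Set (Space n) := openI ×ˢ Q

lemma HasInteriorCones.prod {E E' : Type*} [NormedAddCommGroup E] [NormedSpace ℝ E]
    [NormedAddCommGroup E'] [NormedSpace ℝ E'] {A : Set E} {B : Set E'} (hA : HasInteriorCones A)
    (hB : HasInteriorCones B) : HasInteriorCones (A ×ˢ B) := by
  rintro ⟨p, q⟩ hpq
  rw [closure_prod_eq] at hpq
  obtain ⟨r, hr, z, σ, hσ, h⟩ := hA p hpq.1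
  obtain ⟨r', hr', z', σ', hσ', h'⟩ := hB q hpq.2
  refine ⟨min r r', by positivity, (z, z'), min σ σ', by positivity, ?_⟩
  rintro ⟨x, x'⟩ hx hd ⟨v, v'⟩ hv t ht
  simp only [Prod.dist_eq, max_lt_iff, lt_min_iff] at hd hv
  exact ⟨h x hx.1 hd.1.1 v hv.1.1 t ht, h' x' hx.2 hd.2.2 v' hv.2.2 t ht⟩

lemma mem_openI_iff {s : ℝ} : s ∈ openI ↔ |s| < 1 / 2 := by
  rw [abs_lt, openI, mem_Ioo]; norm_num

lemma closure_openI : closure openI = closedI := closure_Ioo (by norm_num)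

lemma openI_subset_closedI : openI ⊆ closedI := Ioo_subset_Icc_self

lemma hasInteriorCones_openI : HasInteriorCones openI := by
  intro p hp
  refine ⟨1 / 4, by norm_num, -p, 1 / 4, by norm_num, fun x hx hxp v hv t ht => ?_⟩
  rw [mem_openI_iff] at hx ⊢
  rw [Real.dist_eq] at hxp hv
  -- `x + t v` is a convex combination of `x` and of `x + v`, which is close to the midpoint `0`.
  have h1 : |x + v| < 1 / 2 := by
    rw [show x + v = (x - p) + (v - -p) by ring]
    exact (abs_add_le _ _).trans_lt (by linarith)
  rw [abs_lt] at hx h1 ⊢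
  rw [smul_eq_mul]
  have h2 := ht.1
  have h3 := ht.2
  constructor <;> nlinarith

/-- At a boundary point, the cone is a small ball of directions around a multiple of the vertical
direction `e`: if the horizontal part of `v` times the Lipschitz constant is less than the vertical
part of `v`, then translation by `v` preserves the epigraph. -/
lemma IsLipschitzDomain.hasInteriorCones {Q : Set (Cross n)} (hQ : IsLipschitzDomain Q) :
    HasInteriorCones Q := by
  intro p hp
  by_cases hpQ : p ∈ Q
  · obtain ⟨r, hr, hrQ⟩ := Metric.isOpen_iff.1 hQ.1 p hpQ
    refine ⟨r / 2, by positivity, 0, r / 2, by positivity, fun x hx hxp v hv t ht => hrQ ?_⟩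
    rw [dist_zero_right] at hv
    rw [Metric.mem_ball, dist_eq_norm] at *
    calc ‖x + t • v - p‖ = ‖(x - p) + t • v‖ := by congr 1; abel
      _ ≤ ‖x - p‖ + ‖t • v‖ := norm_add_le _ _
      _ = ‖x - p‖ + t * ‖v‖ := by rw [norm_smul, Real.norm_of_nonneg ht.1.le]
      _ < r := by nlinarith [norm_nonneg v, ht.2]
  · obtain ⟨e, L, h, r, he, hL, hr, hep⟩ := hQ.2.2.2 p (by
      rw [frontier, hQ.1.interior_eq]; exact ⟨hp, hpQ⟩)
    set s := r / 4 with hs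
    have hs0 : 0 < s := by positivity
    set σ := s / (2 * (2 * L + 1)) with hσ
    have hσ0 : 0 < σ := by positivity
    have hσs : 2 * (2 * L + 1) * σ = s := by rw [hσ]; field_simp
    have hL0 : (0 : ℝ) ≤ L := L.2
    refine ⟨r / 2, by positivity, s • e, σ, hσ0, fun x hx hxp v hv t ht => ?_⟩
    rw [dist_eq_norm] at hxp hv
    have hee : inner ℝ e e = (1 : ℝ) := by rw [real_inner_self_eq_norm_sq, he]; norm_num
    have hvn : ‖v‖ ≤ s + σ := by
      calc ‖v‖ = ‖(v - s • e) + s • e‖ := by rw [sub_add_cancel]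
        _ ≤ ‖v - s • e‖ + ‖s • e‖ := norm_add_le _ _
        _ ≤ σ + s := by
          rw [norm_smul, he, mul_one, Real.norm_of_nonneg hs0.le]; linarith
        _ = s + σ := add_comm _ _
    have hxr : x ∈ Metric.ball p r := by rw [Metric.mem_ball, dist_eq_norm]; linarith
    have hxvr : x + t • v ∈ Metric.ball p r := by
      rw [Metric.mem_ball, dist_eq_norm]
      calc ‖x + t • v - p‖ = ‖(x - p) + t • v‖ := by congr 1; abel
        _ ≤ ‖x - p‖ + ‖t • v‖ := norm_add_le _ _
        _ = ‖x - p‖ + t * ‖v‖ := by rw [norm_smul, Real.norm_of_nonneg ht.1.le]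
        _ < r := by nlinarith [norm_nonneg v, ht.2]
    have hin : |inner ℝ e (v - s • e)| ≤ σ := by
      refine (abs_real_inner_le_norm _ _).trans ?_
      rw [he, one_mul]; exact hv.le
    have hev : inner ℝ e v = s + inner ℝ e (v - s • e) := by
      rw [inner_sub_right, real_inner_smul_right, hee]; ring
    have hvh : ‖v - inner ℝ e v • e‖ ≤ 2 * σ := by
      have : v - inner ℝ e v • e = (v - s • e) - inner ℝ e (v - s • e) • e := by
        rw [hev, add_smul]; abel
      rw [this]
      refine (norm_sub_le _ _).trans ?_
      rw [norm_smul, he, mul_one, Real.norm_eq_abs]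
      linarith
    rw [hep _ hxvr]
    have hx' := (hep x hxr).1 hx
    have hdec : x + t • v - inner ℝ e (x + t • v) • e - (x - inner ℝ e x • e) =
        t • (v - inner ℝ e v • e) := by
      rw [inner_add_right, real_inner_smul_right, add_smul, smul_sub, smul_smul]; abel
    have hh : h (x + t • v - inner ℝ e (x + t • v) • e) - h (x - inner ℝ e x • e) ≤
        L * (t * (2 * σ)) := by
      refine (le_abs_self _).trans ?_
      have := hL.dist_le_mul (x + t • v - inner ℝ e (x + t • v) • e) (x - inner ℝ e x • e)
      rw [Real.dist_eq, dist_eq_norm, hdec, norm_smul, Real.norm_of_nonneg ht.1.le] at this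
      refine this.trans ?_
      have := ht.1
      gcongr
    have hsig : L * (t * (2 * σ)) < t * inner ℝ e v := by
      have h1 : L * (2 * σ) < inner ℝ e v := by
        rw [hev]; nlinarith [(abs_le.1 hin).1]
      nlinarith [ht.1]
    rw [inner_add_right, real_inner_smul_right]
    rw [inner_add_right, real_inner_smul_right] at hh
    linarith

variable {Q : Set (Cross n)}

lemma IsLipschitzDomain.isOpen_openCell (hQ : IsLipschitzDomain Q) : IsOpen (openCell Q) :=
  isOpen_Ioo.prod hQ.1

lemma IsLipschitzDomain.isBounded_openCell (hQ : IsLipschitzDomain Q) :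
    Bornology.IsBounded (openCell Q) := (Metric.isBounded_Ioo _ _).prod hQ.2.2.1

instance isAddHaarMeasure_volume_space : (volume : Measure (Space n)).IsAddHaarMeasure :=
  inferInstanceAs ((volume : Measure ℝ).prod (volume : Measure (Cross n))).IsAddHaarMeasure

lemma IsLipschitzDomain.oscillationBound_openCell (hQ : IsLipschitzDomain Q) :
    OscillationBound (volume : Measure (Space n)) (openCell Q) (openCell Q) (openCell Q) :=
  oscillationBound_self hQ.isOpen_openCell
    ((isConnected_Ioo (by norm_num)).prod hQ.2.1) hQ.isBounded_openCell
    (hasInteriorCones_openI.prod hQ.hasInteriorCones)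

lemma openCell_subset_cell : openCell Q ⊆ cell Q := prod_mono_left Ioo_subset_Ico_self

lemma openCell_ae_eq_cell : openCell Q =ᵐ[(volume : Measure (Space n))] cell Q :=
  Measure.set_prod_ae_eq Ioo_ae_eq_Ico Filter.EventuallyEq.rfl

lemma exists_forall_mul_rpow_le {α : ℝ} (hα : 0 < α) (K : ℝ) {η : ℝ} (hη : 0 < η) :
    ∃ ρ > 0, ∀ d, 0 ≤ d → d < ρ → K * d ^ α ≤ η := by
  have h : ContinuousAt (fun d : ℝ => K * d ^ α) 0 :=
    (Real.continuousAt_rpow_const 0 α (Or.inr hα.le)).const_mul K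
  have h0 : K * (0 : ℝ) ^ α < η := by rw [Real.zero_rpow hα.ne', mul_zero]; exact hη
  obtain ⟨ρ, hρ, hb⟩ := Metric.eventually_nhds_iff.1 (h.eventually_lt continuousAt_const h0)
  refine ⟨ρ, hρ, fun d hd hdρ => (hb ?_).le⟩
  rwa [Real.dist_eq, sub_zero, abs_of_nonneg hd]

lemma closure_openI_prod : closure (openI ×ˢ openCell Q) = closedI ×ˢ (closedI ×ˢ closure Q) := by
  rw [closure_prod_eq, closure_prod_eq, closure_openI]

end Geometry

section Perforation

variable {n : ℕ} {Q : Set (Cross n)} {α : ℝ} {F : ℝ → Space n → ℝ}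

lemma IsPerforation.continuousOn (hF : IsPerforation Q α F) :
    ContinuousOn (fun p : ℝ × Space n => F p.1 p.2) (closedI ×ˢ (closedI ×ˢ closure Q)) := by
  obtain ⟨⟨DF, h, -⟩, -⟩ := hF; exact h

lemma IsPerforation.exists_measure_strip_le (hF : IsPerforation Q α F) (hα : 0 < α)
    (hQ : IsLipschitzDomain Q) :
    ∃ C : NNReal, ∀ t ∈ openI, ∀ δ > 0,
      volume {y ∈ openCell Q | |F t y| ≤ δ} ≤ ENNReal.ofReal δ * C := by
  obtain ⟨⟨DF, hc, hd, ⟨K, hK⟩, hne⟩, -, h0, -⟩ := hF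
  refine ThinRod.exists_measure_strip_le (J := openI) (f := fun p : ℝ × Space n => F p.1 p.2)
    (f' := DF) hQ.isOpen_openCell.measurableSet
    hQ.isBounded_openCell (Metric.isBounded_Ioo _ _)
    (hasInteriorCones_openI.prod (hasInteriorCones_openI.prod hQ.hasInteriorCones)) hd ?_ ?_
  · intro p hp η hη
    obtain ⟨ρ, hρ, hb⟩ := exists_forall_mul_rpow_le hα K hη
    refine ⟨ρ, hρ, fun x hx hxp => ?_⟩
    have hx' := subset_closure hx
    rw [closure_openI_prod] at hp hx'
    exact (hK x hx' p hp).trans (hb _ dist_nonneg hxp)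
  · intro p hp
    rw [closure_openI_prod] at hp
    by_cases hp0 : p.2 = 0
    · -- At `y = 0` the gradient may vanish, but there `F = -1`.
      right
      have h1 : F p.1 p.2 = -1 := by rw [hp0, h0 _ hp.1]
      have h2 : ∀ᶠ x in nhdsWithin p (closedI ×ˢ (closedI ×ˢ closure Q)),
          F x.1 x.2 < -1 / 2 := (hc p hp).eventually_lt continuousWithinAt_const (by
            simp only [h1]; norm_num)
      obtain ⟨ρ, hρ, hb⟩ := Metric.mem_nhdsWithin_iff.1 h2
      refine ⟨ρ, hρ, 1 / 2, by norm_num, fun x hx hxp => ?_⟩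
      have hx' := subset_closure hx
      rw [closure_openI_prod] at hx'
      have h3 : F x.1 x.2 < -1 / 2 := hb ⟨hxp, hx'⟩
      rw [abs_of_neg (by linarith)]; linarith
    · exact Or.inl (hne p hp hp0)

lemma IsPerforation.exists_lipschitz (hF : IsPerforation Q α F) (hα : 0 < α)
    (hQ : IsLipschitzDomain Q) :
    ∃ L : ℝ, 0 < L ∧ ∀ s ∈ openI, ∀ t ∈ openI, ∀ y ∈ openCell Q,
      |F s y - F t y| ≤ L * |s - t| := by
  obtain ⟨⟨DF, hc, hd, ⟨K, hK⟩, hne⟩, -, h0, -⟩ := hF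
  set D : Set (ℝ × Space n) := closedI ×ˢ (closedI ×ˢ closure Q) with hD
  have hDb : Bornology.IsBounded (openI ×ˢ openCell Q) :=
    (Metric.isBounded_Ioo _ _).prod hQ.isBounded_openCell
  have hsub : openI ×ˢ openCell Q ⊆ D := by
    rw [hD, ← closure_openI_prod]; exact subset_closure
  obtain ⟨q, hq⟩ := hQ.2.1.nonempty
  have hp₀ : ((0, (0, q)) : ℝ × Space n) ∈ openI ×ˢ openCell Q :=
    ⟨by simp [mem_openI_iff], by simp [mem_openI_iff], hq⟩
  obtain ⟨d, hd0, hdd⟩ : ∃ d, 0 ≤ d ∧ ∀ x ∈ openI ×ˢ openCell Q, dist x (0, (0, q)) ≤ d :=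
    ⟨Metric.diam (openI ×ˢ openCell Q), Metric.diam_nonneg, fun x hx =>
      Metric.dist_le_diam_of_mem hDb hx hp₀⟩
  set L := ‖DF (0, (0, q))‖ + |K| * d ^ α + 1
  have hDF : ∀ x ∈ openI ×ˢ openCell Q, ‖DF x‖ ≤ L := by
    intro x hx
    have h1 := hK x (hsub hx) _ (hsub hp₀)
    have h2 : K * dist x (0, (0, q)) ^ α ≤ |K| * d ^ α := by
      refine mul_le_mul (le_abs_self K) ?_ (by positivity) (abs_nonneg K)
      exact Real.rpow_le_rpow dist_nonneg (hdd x hx) hα.le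
    have h3 := norm_sub_norm_le (DF x) (DF (0, (0, q)))
    linarith
  refine ⟨L, by positivity, fun s hs t ht y hy => ?_⟩
  have hconv : Convex ℝ (openI ×ˢ ({y} : Set (Space n))) :=
    (convex_Ioo _ _).prod (convex_singleton y)
  have hsub' : openI ×ˢ ({y} : Set (Space n)) ⊆ openI ×ˢ openCell Q :=
    prod_mono_right (singleton_subset_iff.2 hy)
  have := hconv.norm_image_sub_le_of_norm_hasFDerivWithin_le
    (f := fun p : ℝ × Space n => F p.1 p.2) (f' := DF) (C := L)
    (fun x hx => (hd x (hsub' hx)).hasFDerivWithinAt) (fun x hx => hDF x (hsub' hx))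
    (show (t, y) ∈ openI ×ˢ ({y} : Set (Space n)) from ⟨ht, rfl⟩)
    (show (s, y) ∈ openI ×ˢ ({y} : Set (Space n)) from ⟨hs, rfl⟩)
  have h4 : ‖((s, y) : ℝ × Space n) - (t, y)‖ = |s - t| := by simp [Prod.norm_def]
  rwa [h4] at this

variable {w : ℝ → Space n → ℝ}

lemma IsC1HolderWeight.exists_lipschitz (hw : IsC1HolderWeight Q α w) (hα : 0 < α) :
    ∃ L : ℝ, 0 ≤ L ∧ ∀ s ∈ closedI, ∀ t ∈ closedI, ∀ y ∈ univ ×ˢ closure Q,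
      |w s y - w t y| ≤ L * |s - t| := by
  obtain ⟨-, -, w', hw', hd, K, hK⟩ := hw
  have h0 : (0 : ℝ) ∈ closedI := by constructor <;> norm_num
  obtain ⟨M₀, hM₀⟩ := hw' 0 h0
  refine ⟨|M₀| + |K|, by positivity, fun s hs t ht y hy => ?_⟩
  have hder : ∀ r ∈ closedI, HasDerivWithinAt (fun r => w r y) (w' r y) closedI r := by
    intro r hr
    rw [hasDerivWithinAt_iff_isLittleO, Asymptotics.isLittleO_iff]
    intro η hη
    obtain ⟨δ, hδ, hb⟩ := hd r hr η hη
    filter_upwards [self_mem_nhdsWithin, mem_nhdsWithin_of_mem_nhds (Metric.ball_mem_nhds r hδ)]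
      with x hx hxr
    exact (hb x hx hxr).1 y hy
  have hbd : ∀ r ∈ closedI, ‖w' r y‖ ≤ |M₀| + |K| := by
    intro r hr
    have h1 := (hK 0 h0 r hr).1 y hy
    have h2 := hM₀.1 y hy
    simp only [sub_zero] at h1
    have h3 : K * |r| ^ α ≤ |K| := by
      have h4 : |r| ^ α ≤ 1 := Real.rpow_le_one (abs_nonneg r)
        (abs_le.2 ⟨by linarith [hr.1], by linarith [hr.2]⟩) hα.le
      have h5 : 0 ≤ |r| ^ α := by positivity
      nlinarith [le_abs_self K, abs_nonneg K]
    have h6 := abs_sub_abs_le_abs_sub (w' r y) (w' 0 y)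
    rw [Real.norm_eq_abs]
    linarith [le_abs_self M₀]
  exact (convex_Icc (-1 / 2 : ℝ) (1 / 2)).norm_image_sub_le_of_norm_hasDerivWithin_le hder hbd ht hs

lemma IsC1HolderWeight.exists_bound (hw : IsC1HolderWeight Q α w) (hα : 0 < α) :
    ∃ M : ℝ, 0 ≤ M ∧ ∀ s ∈ closedI, ∀ y ∈ univ ×ˢ closure Q, |w s y| ≤ M := by
  obtain ⟨L, hL, hLip⟩ := hw.exists_lipschitz hα
  have h0 : (0 : ℝ) ∈ closedI := by constructor <;> norm_num
  obtain ⟨M₀, hM₀⟩ := hw.2.1 0 h0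
  refine ⟨|M₀| + L, by positivity, fun s hs y hy => ?_⟩
  have h1 := hLip s hs 0 h0 y hy
  have h2 := hM₀.1 y hy
  have h3 : |s - 0| ≤ 1 := by
    rw [sub_zero]; exact abs_le.2 ⟨by linarith [hs.1], by linarith [hs.2]⟩
  have h6 := abs_sub_abs_le_abs_sub (w s y) (w 0 y)
  nlinarith [le_abs_self M₀]

lemma IsC1HolderWeight.continuousOn (hw : IsC1HolderWeight Q α w) (hα : 0 < α) :
    ContinuousOn (fun p : ℝ × Space n => w p.1 p.2) (closedI ×ˢ (univ ×ˢ closure Q)) := by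
  obtain ⟨L, hL, hLip⟩ := hw.exists_lipschitz hα
  rintro ⟨s, y⟩ ⟨hs, hy⟩
  obtain ⟨M, hM⟩ := hw.2.1 s hs
  rw [ContinuousWithinAt, tendsto_iff_dist_tendsto_zero]
  refine squeeze_zero' (g := fun p : ℝ × Space n => L * |p.1 - s| + M * dist p.2 y ^ α)
    (Filter.Eventually.of_forall fun _ => dist_nonneg) ?_ ?_
  · filter_upwards [self_mem_nhdsWithin] with p hp
    calc dist (w p.1 p.2) (w s y) ≤ dist (w p.1 p.2) (w s p.2) + dist (w s p.2) (w s y) :=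
          dist_triangle _ _ _
      _ ≤ _ := add_le_add (hLip p.1 hp.1 s hs p.2 hp.2) (hM.2 p.2 hp.2 y hy)
  · have h : ContinuousAt (fun p : ℝ × Space n => L * |p.1 - s| + M * dist p.2 y ^ α) (s, y) := by
      have h1 : ContinuousAt (fun p : ℝ × Space n => dist p.2 y ^ α) (s, y) :=
        ContinuousAt.rpow_const (by fun_prop) (Or.inr hα.le)
      exact (by fun_prop : ContinuousAt (fun p : ℝ × Space n => L * |p.1 - s|) (s, y)).add
        (h1.const_mul M)
    have h2 := h.tendsto
    simp only [sub_self, abs_zero, mul_zero, dist_self, Real.zero_rpow hα.ne', add_zero] at h2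
    exact h2.mono_left nhdsWithin_le_nhds

/-- The density `χ(s, y) w(s, y)` on one periodicity cell, set to zero elsewhere. -/
noncomputable def cellDensity (Q : Set (Cross n)) (F w : ℝ → Space n → ℝ) : ℝ × Space n → ℝ :=
  indicator {p | p ∈ openI ×ˢ cell Q ∧ 0 < F p.1 p.2} fun p => w p.1 p.2

lemma cellDensity_of_pos {s : ℝ} {y : Space n} (hs : s ∈ openI) (hy : y ∈ cell Q)
    (h : 0 < F s y) : cellDensity Q F w (s, y) = w s y :=
  indicator_of_mem (s := {p : ℝ × Space n | p ∈ openI ×ˢ cell Q ∧ 0 < F p.1 p.2}) ⟨⟨hs, hy⟩, h⟩ _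

lemma cellDensity_of_not_pos {s : ℝ} {y : Space n} (h : ¬0 < F s y) :
    cellDensity Q F w (s, y) = 0 :=
  indicator_of_notMem (s := {p : ℝ × Space n | p ∈ openI ×ˢ cell Q ∧ 0 < F p.1 p.2})
    (fun h' => h h'.2) _

lemma cell_subset : cell Q ⊆ closedI ×ˢ closure Q :=
  prod_mono Ico_subset_Icc_self subset_closure

lemma IsPerforation.measurableSet_pos (hF : IsPerforation Q α F) (hQ : IsLipschitzDomain Q) :
    MeasurableSet {p : ℝ × Space n | p ∈ openI ×ˢ cell Q ∧ 0 < F p.1 p.2} := by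
  have hsub : openI ×ˢ cell Q ⊆ closedI ×ˢ (closedI ×ˢ closure Q) :=
    prod_mono openI_subset_closedI cell_subset
  have hm : MeasurableSet (openI ×ˢ cell Q) :=
    measurableSet_Ioo.prod (measurableSet_Ico.prod hQ.1.measurableSet)
  obtain ⟨u, hu, hu'⟩ := continuousOn_iff'.1 (hF.continuousOn.mono hsub) (Ioi 0) isOpen_Ioi
  have : {p : ℝ × Space n | p ∈ openI ×ˢ cell Q ∧ 0 < F p.1 p.2} = u ∩ openI ×ˢ cell Q := by
    rw [← hu', inter_comm]; rfl
  rw [this]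
  exact hu.measurableSet.inter hm

lemma IsPerforation.measurable_cellDensity (hF : IsPerforation Q α F) (hα : 0 < α)
    (hQ : IsLipschitzDomain Q) (hw : IsC1HolderWeight Q α w) : Measurable (cellDensity Q F w) := by
  classical
  rw [cellDensity, ← piecewise_eq_indicator]
  refine ContinuousOn.measurable_piecewise ((hw.continuousOn hα).mono ?_) continuousOn_const
    (hF.measurableSet_pos hQ)
  rintro p ⟨hp, -⟩
  exact ⟨openI_subset_closedI hp.1, mem_univ _, subset_closure hp.2.2⟩

lemma IsC1HolderWeight.exists_cellDensity_bound (hw : IsC1HolderWeight Q α w) (hα : 0 < α) :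
    ∃ M : ℝ, 0 ≤ M ∧ ∀ p, |cellDensity Q F w p| ≤ M := by
  obtain ⟨M, hM, hb⟩ := hw.exists_bound hα
  refine ⟨M, hM, fun p => ?_⟩
  by_cases hp : p ∈ {p : ℝ × Space n | p ∈ openI ×ˢ cell Q ∧ 0 < F p.1 p.2}
  · rw [cellDensity, indicator_of_mem hp]
    exact hb _ (openI_subset_closedI hp.1.1) _ ⟨mem_univ _, subset_closure hp.1.2.2⟩
  · rw [cellDensity, indicator_of_notMem hp]; simpa using hM

/-- The density is Lipschitz in the slow variable in the `L¹` sense: where `F(t, ·)` exceeds the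
possible variation of `F` in modulus the sign of `F` is unchanged, and the remaining strip has
measure of order `δ`. -/
lemma IsPerforation.exists_lintegral_cellDensity_sub_le (hF : IsPerforation Q α F) (hα : 0 < α)
    (hQ : IsLipschitzDomain Q) (hw : IsC1HolderWeight Q α w) :
    ∃ L : ℝ, 0 ≤ L ∧ ∀ t ∈ openI, ∀ δ > 0, ∀ s : Space n → ℝ,
      (∀ y ∈ openCell Q, s y ∈ openI ∧ |s y - t| ≤ δ) →
      ∫⁻ y in openCell Q, ‖cellDensity Q F w (s y, y) - cellDensity Q F w (t, y)‖ₑ ≤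
        ENNReal.ofReal (L * δ) := by
  obtain ⟨M, hM, hb⟩ := hw.exists_bound hα
  obtain ⟨M', hM', hb'⟩ := hw.exists_cellDensity_bound (F := F) hα
  obtain ⟨L₁, hL₁, hw₁⟩ := hw.exists_lipschitz hα
  obtain ⟨L₂, hL₂, hF₂⟩ := hF.exists_lipschitz hα hQ
  obtain ⟨C, hC⟩ := hF.exists_measure_strip_le hα hQ
  have hV : volume (openCell Q) ≠ ⊤ := hQ.isBounded_openCell.measure_lt_top.ne
  refine ⟨L₁ * volume.real (openCell Q) + 2 * M' * (L₂ * C), by positivity,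
    fun t ht δ hδ s hs => ?_⟩
  set S : Set (Space n) := {y ∈ openCell Q | |F t y| ≤ L₂ * δ}
  have hpt : ∀ y ∈ openCell Q, ‖cellDensity Q F w (s y, y) - cellDensity Q F w (t, y)‖ₑ ≤
      ENNReal.ofReal (L₁ * δ) + S.indicator (fun _ => ENNReal.ofReal (2 * M')) y := by
    intro y hy
    rw [← ofReal_norm, Real.norm_eq_abs]
    by_cases hyS : y ∈ S
    · rw [indicator_of_mem hyS]
      refine le_add_left (ENNReal.ofReal_le_ofReal ?_)
      exact (abs_sub _ _).trans (by linarith [hb' (s y, y), hb' (t, y)])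
    · rw [indicator_of_notMem hyS, add_zero]
      apply ENNReal.ofReal_le_ofReal
      have hlt : L₂ * δ < |F t y| := by
        by_contra hle
        exact hyS ⟨hy, not_lt.1 hle⟩
      obtain ⟨hsI, hsδ⟩ := hs y hy
      have hv : |F (s y) y - F t y| ≤ L₂ * δ :=
        (hF₂ _ hsI t ht y hy).trans (by gcongr)
      have hsign : 0 < F (s y) y ↔ 0 < F t y := by
        rw [abs_le] at hv
        rcases lt_abs.1 hlt with h | h
        · constructor <;> intro _ <;> nlinarith
        · constructor <;> intro _ <;> nlinarith
      have hyc := openCell_subset_cell hy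
      by_cases hpos : 0 < F t y
      · rw [cellDensity_of_pos hsI hyc (hsign.2 hpos), cellDensity_of_pos ht hyc hpos]
        exact (hw₁ _ (openI_subset_closedI hsI) t (openI_subset_closedI ht) y
          ⟨mem_univ _, subset_closure hy.2⟩).trans (by gcongr)
      · rw [cellDensity_of_not_pos (hpos ∘ hsign.1), cellDensity_of_not_pos hpos, sub_zero,
          abs_zero]
        positivity
  calc _ ≤ ∫⁻ y in openCell Q, (ENNReal.ofReal (L₁ * δ)
          + S.indicator (fun _ => ENNReal.ofReal (2 * M')) y) :=
        setLIntegral_mono' hQ.isOpen_openCell.measurableSet hpt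
    _ = ENNReal.ofReal (L₁ * δ) * volume (openCell Q)
          + ∫⁻ y in openCell Q, S.indicator (fun _ => ENNReal.ofReal (2 * M')) y := by
        rw [lintegral_add_left measurable_const, lintegral_const, Measure.restrict_apply_univ]
    _ ≤ ENNReal.ofReal (L₁ * δ) * volume (openCell Q)
          + ENNReal.ofReal (2 * M') * (ENNReal.ofReal (L₂ * δ) * C) := by
        gcongr
        refine (setLIntegral_le_lintegral _ _).trans ((lintegral_indicator_const_le _ _).trans ?_)
        gcongr
        exact hC t ht _ (by positivity)
    _ = _ := by
        rw [← ENNReal.ofReal_toReal hV, ← ENNReal.ofReal_coe_nnreal,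
          ← ENNReal.ofReal_mul (by positivity), ← ENNReal.ofReal_mul (by positivity),
          ← ENNReal.ofReal_mul (by positivity), ← ENNReal.ofReal_add (by positivity)
          (by positivity)]
        congr 1
        rw [measureReal_def]; ring

end Perforation

/-! ### The estimate on one periodicity cell -/

section CellEstimate

variable {E : Type*} [NormedAddCommGroup E] [NormedSpace ℝ E] [FiniteDimensional ℝ E]
  [MeasurableSpace E] [BorelSpace E] {μ : Measure E}

lemma integrableOn_of_continuous_of_isBounded [IsFiniteMeasureOnCompacts μ] {F : Type*}
    [NormedAddCommGroup F] {f : E → F} (hf : Continuous f) {P : Set E}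
    (hP : Bornology.IsBounded P) : IntegrableOn f P μ :=
  haveI : ProperSpace E := FiniteDimensional.proper_real E
  (hf.continuousOn.integrableOn_compact hP.isCompact_closure).mono_set subset_closure

variable [μ.IsAddHaarMeasure]

/-- Splitting `u` into its mean and its oscillation: a bounded weight `r` sees the mean only through
its own integral, and the oscillation only through the Poincaré inequality. -/
lemma OscillationBound.exists_abs_integral_mul_le {P : Set E} (h : OscillationBound μ P P P)
    (hPb : Bornology.IsBounded P) (hP0 : μ P ≠ 0) :
    ∃ C : ℝ, 0 ≤ C ∧ ∀ (r : E → ℝ) (B : ℝ), Measurable r → (∀ x, |r x| ≤ B) →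
      ∀ u : E → ℝ, ContDiff ℝ 1 u →
        |∫ x in P, r x * u x ∂μ| ≤ C * B * ∫ x in P, ‖fderiv ℝ u x‖ ∂μ +
          (μ.real P)⁻¹ * |∫ x in P, r x ∂μ| * |∫ x in P, u x ∂μ| := by
  obtain ⟨C, hC⟩ := h
  have hPt : μ P ≠ ⊤ := hPb.measure_lt_top.ne
  have hV : 0 < μ.real P := ENNReal.toReal_pos hP0 hPt
  refine ⟨(μ.real P)⁻¹ * C, by positivity, fun r B hr hrB u hu => ?_⟩
  have hB : 0 ≤ B := (abs_nonneg _).trans (hrB 0)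
  have : IsFiniteMeasure (μ.restrict P) := ⟨by simpa using hPt.lt_top⟩
  have hui : IntegrableOn u P μ := integrableOn_of_continuous_of_isBounded hu.continuous hPb
  have hdi : IntegrableOn (fun x => ‖fderiv ℝ u x‖) P μ :=
    integrableOn_of_continuous_of_isBounded (hu.continuous_fderiv one_ne_zero).norm hPb
  set m := (μ.real P)⁻¹ * ∫ x in P, u x ∂μ with hm
  have hri : IntegrableOn r P μ :=
    Integrable.of_bound hr.aestronglyMeasurable B (Filter.Eventually.of_forall hrB)
  have hrui : IntegrableOn (fun x => r x * (u x - m)) P μ :=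
    (hui.sub (integrable_const m)).bdd_mul hr.aestronglyMeasurable
      (Filter.Eventually.of_forall hrB)
  have hsplit : ∫ x in P, r x * u x ∂μ =
      ∫ x in P, r x * (u x - m) ∂μ + (∫ x in P, r x ∂μ) * m := by
    rw [← integral_mul_const, ← integral_add hrui (hri.mul_const m)]
    congr 1; ext x; ring
  have hosc : |∫ x in P, r x * (u x - m) ∂μ| ≤
      (μ.real P)⁻¹ * C * B * ∫ x in P, ‖fderiv ℝ u x‖ ∂μ := by
    have hpt : ∀ x, ‖u x - m‖ₑ ≤ ENNReal.ofReal (μ.real P)⁻¹ * ∫⁻ y in P, ‖u x - u y‖ₑ ∂μ := by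
      intro x
      have h1 : u x - m = (μ.real P)⁻¹ * ∫ y in P, (u x - u y) ∂μ := by
        rw [integral_sub (integrable_const _) hui, setIntegral_const, smul_eq_mul, mul_sub,
          ← mul_assoc, inv_mul_cancel₀ hV.ne', one_mul]
      rw [h1, enorm_mul, Real.enorm_of_nonneg (by positivity)]
      gcongr
      exact enorm_integral_le_lintegral_enorm _
    have h2 : ‖∫ x in P, r x * (u x - m) ∂μ‖ₑ ≤
        ENNReal.ofReal ((μ.real P)⁻¹ * C * B * ∫ x in P, ‖fderiv ℝ u x‖ ∂μ) := by
      calc ‖∫ x in P, r x * (u x - m) ∂μ‖ₑ ≤ ∫⁻ x in P, ‖r x * (u x - m)‖ₑ ∂μ :=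
            enorm_integral_le_lintegral_enorm _
        _ ≤ ∫⁻ x in P, ENNReal.ofReal B * (ENNReal.ofReal (μ.real P)⁻¹ *
              ∫⁻ y in P, ‖u x - u y‖ₑ ∂μ) ∂μ := by
            refine lintegral_mono fun x => ?_
            rw [enorm_mul]
            gcongr
            · rw [← ofReal_norm]; exact ENNReal.ofReal_le_ofReal (hrB x)
            · exact hpt x
        _ = ENNReal.ofReal B * (ENNReal.ofReal (μ.real P)⁻¹ *
              ∫⁻ x in P, ∫⁻ y in P, ‖u x - u y‖ₑ ∂μ ∂μ) := by
            rw [lintegral_const_mul' _ _ ENNReal.ofReal_ne_top,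
              lintegral_const_mul' _ _ ENNReal.ofReal_ne_top]
        _ ≤ ENNReal.ofReal B * (ENNReal.ofReal (μ.real P)⁻¹ *
              (C * ∫⁻ x in P, ‖fderiv ℝ u x‖ₑ ∂μ)) := by
            gcongr; exact hC u hu
        _ = _ := by
            rw [← ofReal_integral_norm_eq_lintegral_enorm
              (integrableOn_of_continuous_of_isBounded (hu.continuous_fderiv one_ne_zero) hPb),
              ← ENNReal.ofReal_coe_nnreal, ← ENNReal.ofReal_mul (by positivity),
              ← ENNReal.ofReal_mul (by positivity), ← ENNReal.ofReal_mul hB]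
            congr 1; ring
    rw [← ofReal_norm, Real.norm_eq_abs] at h2
    exact (ENNReal.ofReal_le_ofReal_iff (by positivity)).1 h2
  rw [hsplit]
  refine (abs_add_le _ _).trans (add_le_add hosc (le_of_eq ?_))
  rw [abs_mul, hm, abs_mul, abs_of_pos (inv_pos.2 hV)]; ring

end CellEstimate

section Density

variable {n : ℕ} {Q : Set (Cross n)}

/-- The mean over the periodicity cell of a density `H(s, ·)`. -/
noncomputable def cellMean (Q : Set (Cross n)) (H : ℝ × Space n → ℝ) (s : ℝ) : ℝ :=
  (volume.real (openCell Q))⁻¹ * ∫ y in openCell Q, H (s, y)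

lemma measurable_cellMean {H : ℝ × Space n → ℝ} (hH : Measurable H) : Measurable (cellMean Q H) :=
  (hH.stronglyMeasurable.integral_prod_right'
    (ν := volume.restrict (openCell Q))).measurable.const_mul _

lemma abs_cellMean_le {H : ℝ × Space n → ℝ} {M : ℝ} (hM : 0 ≤ M) (hb : ∀ p, |H p| ≤ M) (s : ℝ) :
    |cellMean Q H s| ≤ M := by
  rcases eq_or_ne (volume (openCell Q)) ⊤ with h | h
  · simp [cellMean, measureReal_def, h, hM]
  have h1 : |∫ y in openCell Q, H (s, y)| ≤ M * volume.real (openCell Q) :=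
    norm_setIntegral_le_of_norm_le_const (f := fun y => H (s, y)) h.lt_top fun y _ => hb (s, y)
  rw [cellMean, abs_mul, abs_of_nonneg (by positivity)]
  rcases eq_or_ne (volume.real (openCell Q)) 0 with h0 | h0
  · simp [h0, hM]
  · have : 0 < volume.real (openCell Q) := lt_of_le_of_ne measureReal_nonneg h0.symm
    calc _ ≤ (volume.real (openCell Q))⁻¹ * (M * volume.real (openCell Q)) := by gcongr
      _ = M := by field_simp

/-- A bounded measurable density `H(s, y)` on the periodicity cell which is Lipschitz in the slow
variable `s ∈ (-1/2, 1/2)`, in the `L¹` sense with respect to `y`. The slow variable may be frozen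
at `t` even where it varies with `y`. -/
structure IsSlowDensity (Q : Set (Cross n)) (H : ℝ × Space n → ℝ) (M L : ℝ) : Prop where
  measurable : Measurable H
  bound_nonneg : 0 ≤ M
  abs_le : ∀ p, |H p| ≤ M
  lipschitz_nonneg : 0 ≤ L
  lintegral_sub_le : ∀ t ∈ openI, ∀ δ > 0, ∀ s : Space n → ℝ,
    (∀ y ∈ openCell Q, s y ∈ openI ∧ |s y - t| ≤ δ) →
    ∫⁻ y in openCell Q, ‖H (s y, y) - H (t, y)‖ₑ ≤ ENNReal.ofReal (L * δ)

/-- The deviation of a density from its cell mean has small integral over a cell along which the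
slow variable varies by at most `δ`. -/
lemma IsSlowDensity.abs_integral_sub_cellMean_le {H : ℝ × Space n → ℝ} {M L : ℝ}
    (hH : IsSlowDensity Q H M L) (hQ : IsLipschitzDomain Q) {t δ : ℝ} (ht : t ∈ openI)
    (hδ : 0 < δ) {s : Space n → ℝ} (hs : Measurable s)
    (hsI : ∀ y ∈ openCell Q, s y ∈ openI ∧ |s y - t| ≤ δ) :
    |∫ y in openCell Q, (H (s y, y) - cellMean Q H (s y))| ≤ 2 * L * δ := by
  have hPt : volume (openCell Q) ≠ ⊤ := hQ.isBounded_openCell.measure_lt_top.ne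
  have : IsFiniteMeasure (volume.restrict (openCell Q)) := ⟨by simpa using hPt.lt_top⟩
  have hP0 : volume (openCell Q) ≠ 0 := by
    refine (hQ.isOpen_openCell.measure_pos volume ?_).ne'
    exact (nonempty_Ioo.2 (by norm_num)).prod hQ.2.1.nonempty
  have hV : 0 < volume.real (openCell Q) :=
    ENNReal.toReal_pos hP0 hPt
  have hL := hH.lipschitz_nonneg
  have habs : ∀ s : Space n → ℝ, (∀ y ∈ openCell Q, s y ∈ openI ∧ |s y - t| ≤ δ) →
      |∫ y in openCell Q, (H (s y, y) - H (t, y))| ≤ L * δ := by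
    intro s hsI
    have := (enorm_integral_le_lintegral_enorm _).trans (hH.lintegral_sub_le t ht δ hδ s hsI)
    rw [← ofReal_norm, Real.norm_eq_abs] at this
    exact (ENNReal.ofReal_le_ofReal_iff (by positivity)).1 this
  have hi1 : ∀ s : Space n → ℝ, Measurable s → IntegrableOn (fun y => H (s y, y)) (openCell Q) :=
    fun s hs => Integrable.of_bound
      (hH.measurable.comp (hs.prodMk measurable_id)).aestronglyMeasurable M
      (Filter.Eventually.of_forall fun y => hH.abs_le _)
  have hi2 : IntegrableOn (fun y => cellMean Q H (s y)) (openCell Q) :=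
    Integrable.of_bound
      ((measurable_cellMean hH.measurable).comp hs).aestronglyMeasurable M
      (Filter.Eventually.of_forall fun y => abs_cellMean_le hH.bound_nonneg hH.abs_le _)
  have hmean : ∀ y ∈ openCell Q,
      |cellMean Q H (s y) - cellMean Q H t| ≤ (volume.real (openCell Q))⁻¹ * (L * δ) := by
    intro y hy
    rw [cellMean, cellMean, ← mul_sub, ← integral_sub (hi1 _ measurable_const)
      (hi1 _ measurable_const), abs_mul, abs_of_pos (inv_pos.2 hV)]
    gcongr
    exact habs (fun _ => s y) fun _ _ => hsI y hy
  have hmt : ∫ y in openCell Q, H (t, y) = volume.real (openCell Q) * cellMean Q H t := by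
    rw [cellMean, ← mul_assoc, mul_inv_cancel₀ hV.ne', one_mul]
  have hsplit : ∫ y in openCell Q, (H (s y, y) - cellMean Q H (s y)) =
      (∫ y in openCell Q, (H (s y, y) - H (t, y))) -
        ∫ y in openCell Q, (cellMean Q H (s y) - cellMean Q H t) := by
    rw [integral_sub (hi1 s hs) hi2, integral_sub (hi1 s hs) (hi1 (fun _ => t) measurable_const),
      integral_sub hi2 (integrable_const _), hmt, setIntegral_const, smul_eq_mul]
    ring
  have h2 : |∫ y in openCell Q, (cellMean Q H (s y) - cellMean Q H t)| ≤ L * δ := by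
    have := norm_setIntegral_le_of_norm_le_const
      (f := fun y => cellMean Q H (s y) - cellMean Q H t) hPt.lt_top hmean
    rw [Real.norm_eq_abs] at this
    refine this.trans (le_of_eq ?_)
    field_simp
  rw [hsplit]
  calc _ ≤ _ := abs_sub _ _
    _ ≤ L * δ + L * δ := add_le_add (habs s hsI) h2
    _ = _ := by ring

/-- The estimate on a single rescaled cell. -/
lemma IsSlowDensity.exists_abs_integral_cell_le {H : ℝ × Space n → ℝ} {M L : ℝ}
    (hH : IsSlowDensity Q H M L) (hQ : IsLipschitzDomain Q) :
    ∃ C : ℝ, 0 ≤ C ∧ ∀ t ∈ openI, ∀ δ > 0, ∀ s : Space n → ℝ, Measurable s →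
      (∀ y ∈ openCell Q, s y ∈ openI ∧ |s y - t| ≤ δ) →
      ∀ u : Space n → ℝ, ContDiff ℝ 1 u → (∀ y, 0 ≤ u y) →
        |∫ y in openCell Q, (H (s y, y) - cellMean Q H (s y)) * u y| ≤
          C * ((∫ y in openCell Q, ‖fderiv ℝ u y‖) + δ * ∫ y in openCell Q, u y) := by
  have hP0 : volume (openCell Q) ≠ 0 := by
    refine (hQ.isOpen_openCell.measure_pos volume ?_).ne'
    exact (nonempty_Ioo.2 (by norm_num)).prod hQ.2.1.nonempty
  obtain ⟨C, hC0, hC⟩ := hQ.oscillationBound_openCell.exists_abs_integral_mul_le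
    hQ.isBounded_openCell hP0
  have hM := hH.bound_nonneg
  have hL := hH.lipschitz_nonneg
  set V := volume.real (openCell Q)
  refine ⟨C * (2 * M) + V⁻¹ * (2 * L), by positivity, fun t ht δ hδ s hs hsI u hu hu0 => ?_⟩
  have hu0' : 0 ≤ ∫ y in openCell Q, u y := integral_nonneg hu0
  have hd0 : 0 ≤ ∫ y in openCell Q, ‖fderiv ℝ u y‖ := integral_nonneg fun _ => norm_nonneg _
  have hr : Measurable fun y => H (s y, y) - cellMean Q H (s y) :=
    (hH.measurable.comp (hs.prodMk measurable_id)).sub ((measurable_cellMean hH.measurable).comp hs)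
  have h1 := hC _ (2 * M) hr (fun y => (abs_sub _ _).trans (by
    linarith [hH.abs_le (s y, y), abs_cellMean_le (Q := Q) hM hH.abs_le (s y)])) u hu
  have h2 := hH.abs_integral_sub_cellMean_le hQ ht hδ hs hsI
  rw [abs_of_nonneg hu0'] at h1
  have hV : 0 ≤ V⁻¹ := by positivity
  have h3 : V⁻¹ * |∫ y in openCell Q, (H (s y, y) - cellMean Q H (s y))| *
      ∫ y in openCell Q, u y ≤ V⁻¹ * (2 * L * δ) * ∫ y in openCell Q, u y := by gcongr
  have h4 : 0 ≤ C * (2 * M) * (δ * ∫ y in openCell Q, u y) := by positivity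
  have h5 : 0 ≤ V⁻¹ * (2 * L) * ∫ y in openCell Q, ‖fderiv ℝ u y‖ := by positivity
  nlinarith

end Density

/-! ### Summation over the cells of the rod -/

section Rod

variable {n : ℕ} {Q : Set (Cross n)}

lemma integrableOn_comp_smul {f : Space n → ℝ} {S : Set (Space n)} (hS : MeasurableSet S) {r : ℝ}
    (hr : r ≠ 0) (hf : IntegrableOn f (r • S)) : IntegrableOn (fun x => f (r • x)) S := by
  have hrS : MeasurableSet (r • S) := hS.const_smul₀ r
  rw [← integrable_indicator_iff hrS, ← integrable_comp_smul_iff volume _ hr] at hf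
  rw [← integrable_indicator_iff hS]
  suffices heq : S.indicator (fun x => f (r • x)) = fun x => (r • S).indicator f (r • x) by
    rwa [heq]
  ext x
  by_cases hx : x ∈ S
  · rw [indicator_of_mem hx, indicator_of_mem (smul_mem_smul_set hx)]
  · rw [indicator_of_notMem hx, indicator_of_notMem]
    rwa [smul_mem_smul_set_iff₀ hr]

lemma setIntegral_add_left {E : Type*} [NormedAddCommGroup E] [MeasurableSpace E] [BorelSpace E]
    {μ : Measure E} [μ.IsAddLeftInvariant] (g : E → ℝ) {S T : Set E} (hS : MeasurableSet S)
    (hT : MeasurableSet T) (c : E) (h : ∀ y, c + y ∈ T ↔ y ∈ S) :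
    ∫ x in T, g x ∂μ = ∫ y in S, g (c + y) ∂μ := by
  rw [← integral_indicator hT, ← integral_indicator hS, ← integral_add_left_eq_self _ c]
  congr 1; ext y
  by_cases hy : y ∈ S
  · rw [indicator_of_mem hy, indicator_of_mem ((h y).2 hy)]
  · rw [indicator_of_notMem hy, indicator_of_notMem (mt (h y).1 hy)]

lemma rod_eq_smul_prod (N : ℕ) {ε : ℝ} (hε : ε = 1 / (2 * (N : ℝ) + 1)) :
    rod Q ε = ε • (Ioo (-(N : ℝ) - 1 / 2) (N + 1 / 2) ×ˢ Q) := by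
  have hN : (0 : ℝ) < 2 * (N : ℝ) + 1 := by positivity
  have hε0 : ε ≠ 0 := by rw [hε]; positivity
  ext x
  have hinv : ε⁻¹ = 2 * (N : ℝ) + 1 := by rw [hε, one_div, inv_inv]
  rw [mem_smul_set_iff_inv_smul_mem₀ hε0, rod, mem_prod, mem_prod,
    mem_smul_set_iff_inv_smul_mem₀ hε0, Prod.smul_fst, Prod.smul_snd, openI, mem_Ioo, mem_Ioo,
    smul_eq_mul]
  refine and_congr_left' ?_
  rw [hinv]
  constructor
  · rintro ⟨h1, h2⟩; constructor <;> nlinarith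
  · rintro ⟨h1, h2⟩; constructor <;> nlinarith

/-- The rod of thickness `ε = 1 / (2 N + 1)` consists, up to a null set, of `2 N + 1` cells of size
`ε`. The number of cells is odd, so the cells are centred at integer multiples of `ε`. -/
lemma setIntegral_rod_eq_sum (hQ : IsLipschitzDomain Q) (N : ℕ) {ε : ℝ}
    (hε : ε = 1 / (2 * (N : ℝ) + 1)) {f : Space n → ℝ} (hf : IntegrableOn f (rod Q ε)) :
    ∫ x in rod Q ε, f x = ε ^ (n + 1) * ∑ k ∈ Finset.range (2 * N + 1),
      ∫ y in openCell Q, f (ε • ((((k : ℝ) - N, 0) : Space n) + y)) := by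
  have hε0 : 0 < ε := by rw [hε]; positivity
  have hQm := hQ.1.measurableSet
  set g : Space n → ℝ := fun x => f (ε • x) with hg
  set S : Set (Space n) := Ioo (-(N : ℝ) - 1 / 2) (N + 1 / 2) ×ˢ Q with hS
  set T : ℕ → Set (Space n) := fun k => Ico ((k : ℝ) - N - 1 / 2) (k - N + 1 / 2) ×ˢ Q with hT
  have hTm : ∀ k, MeasurableSet (T k) := fun k => measurableSet_Ico.prod hQm
  have hSm : MeasurableSet S := measurableSet_Ioo.prod hQm
  rw [rod_eq_smul_prod N hε] at hf ⊢
  have h1 := Measure.setIntegral_comp_smul_of_pos volume f S hε0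
  have hdim : Module.finrank ℝ (Space n) = n + 1 := by
    simp [Module.finrank_prod, add_comm]
  rw [hdim, smul_eq_mul, inv_mul_eq_div, eq_div_iff (by positivity), mul_comm] at h1
  rw [← h1]
  congr 1
  have hunion : Ico (-(N : ℝ) - 1 / 2) (N + 1 / 2) ×ˢ Q = ⋃ k ∈ Finset.range (2 * N + 1), T k := by
    ext x
    simp only [hT, mem_prod, mem_Ico, mem_iUnion, Finset.mem_range, exists_prop]
    constructor
    · rintro ⟨⟨ha, hb⟩, hx⟩
      have h0 : 0 ≤ x.1 + N + 1 / 2 := by linarith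
      have h2 := Nat.floor_le h0
      have h3 := Nat.lt_floor_add_one (x.1 + N + 1 / 2)
      refine ⟨⌊x.1 + N + 1 / 2⌋₊, ?_, ⟨by linarith, by linarith⟩, hx⟩
      rw [Nat.floor_lt h0]; push_cast; linarith
    · rintro ⟨k, hk, ⟨ha, hb⟩, hx⟩
      have hk' : (k : ℝ) ≤ 2 * N := by exact_mod_cast Nat.lt_succ_iff.1 hk
      have hk0 : (0 : ℝ) ≤ k := k.cast_nonneg
      exact ⟨⟨by linarith, by linarith⟩, hx⟩
  have hae : S =ᵐ[volume] Ico (-(N : ℝ) - 1 / 2) (N + 1 / 2) ×ˢ Q :=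
    Measure.set_prod_ae_eq Ioo_ae_eq_Ico Filter.EventuallyEq.rfl
  have hgi : IntegrableOn g (⋃ k ∈ Finset.range (2 * N + 1), T k) := by
    rw [← hunion]
    exact (integrableOn_comp_smul hSm hε0.ne' hf).congr_set_ae hae.symm
  rw [setIntegral_congr_set hae, hunion, integral_biUnion_finset _ (fun k _ => hTm k)]
  · refine Finset.sum_congr rfl fun k _ => ?_
    rw [setIntegral_congr_set openCell_ae_eq_cell]
    refine setIntegral_add_left g (measurableSet_Ico.prod hQm) (hTm k) _ fun y => ?_
    simp only [hT, mem_prod, mem_Ico, Prod.fst_add, Prod.snd_add, zero_add]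
    refine and_congr_left' ?_
    constructor <;> rintro ⟨h1, h2⟩ <;> constructor <;> linarith
  · intro i _ j _ hij
    rw [Function.onFun, Set.disjoint_left]
    rintro x ⟨⟨ha, hb⟩, -⟩ ⟨⟨ha', hb'⟩, -⟩
    apply hij
    have h1 : (i : ℝ) < (j + 1 : ℕ) := by push_cast; linarith
    have h2 : (j : ℝ) < (i + 1 : ℕ) := by push_cast; linarith
    have h1' : i < j + 1 := by exact_mod_cast h1
    have h2' : j < i + 1 := by exact_mod_cast h2
    omega
  · exact fun k hk => hgi.mono_set (subset_biUnion_of_mem hk)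

lemma sqLen_grad (φ : Space n → ℝ) (x : Space n) :
    sqLen (grad φ x) = fderiv ℝ φ x (1, 0) ^ 2 +
      ∑ i, fderiv ℝ φ x (0, EuclideanSpace.single i 1) ^ 2 := by
  simp [sqLen, grad, EuclideanSpace.norm_sq_eq]

lemma continuous_sqLen_grad {φ : Space n → ℝ} (hφ : ContDiff ℝ 1 φ) :
    Continuous fun x => sqLen (grad φ x) := by
  have h := hφ.continuous_fderiv one_ne_zero
  simp_rw [sqLen_grad]
  fun_prop

lemma sqLen_nonneg (a : Space n) : 0 ≤ sqLen a := by unfold sqLen; positivity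

lemma sq_norm_fderiv_le (φ : Space n → ℝ) (x : Space n) :
    ‖fderiv ℝ φ x‖ ^ 2 ≤ 2 * sqLen (grad φ x) := by
  set D := fderiv ℝ φ x with hD
  set g := grad φ x with hg
  have hDv : ∀ v : Space n, D v = v.1 * g.1 + inner ℝ g.2 v.2 := by
    intro v
    have hv : v = v.1 • ((1, 0) : Space n) +
        ∑ i, v.2 i • ((0, EuclideanSpace.single i 1) : Space n) := by
      ext i
      · simp [Prod.fst_sum]
      · simp [Prod.snd_sum, Pi.single_apply]
    conv_lhs => rw [hv]
    simp only [map_add, map_sum, map_smul, smul_eq_mul, PiLp.inner_apply]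
    rfl
  have h1 : ‖D‖ ≤ |g.1| + ‖g.2‖ := by
    refine D.opNorm_le_bound (by positivity) fun v => ?_
    rw [hDv, Real.norm_eq_abs, add_mul]
    refine (abs_add_le _ _).trans (add_le_add ?_ ?_)
    · rw [abs_mul, mul_comm]
      gcongr
      exact norm_fst_le v
    · refine (abs_real_inner_le_norm _ _).trans ?_
      gcongr
      exact norm_snd_le v
  calc ‖D‖ ^ 2 ≤ (|g.1| + ‖g.2‖) ^ 2 := by gcongr
    _ ≤ 2 * (|g.1| ^ 2 + ‖g.2‖ ^ 2) := by nlinarith [sq_nonneg (|g.1| - ‖g.2‖)]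
    _ = _ := by rw [sq_abs, sqLen]

lemma normL2_nonneg (μ : Measure (Space n)) (v : Space n → ℝ) : 0 ≤ normL2 μ v :=
  Real.sqrt_nonneg _

lemma normL2Vec_nonneg (μ : Measure (Space n)) (g : Space n → Space n) : 0 ≤ normL2Vec μ g :=
  Real.sqrt_nonneg _

lemma sq_normL2 (μ : Measure (Space n)) (v : Space n → ℝ) : normL2 μ v ^ 2 = ∫ x, v x ^ 2 ∂μ :=
  Real.sq_sqrt (integral_nonneg fun _ => sq_nonneg _)

lemma integral_abs_mul_abs_le_normL2_mul {μ : Measure (Space n)} {f g : Space n → ℝ}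
    (hf : MemLp f 2 μ) (hg : MemLp g 2 μ) :
    ∫ x, |f x| * |g x| ∂μ ≤ normL2 μ f * normL2 μ g := by
  have h := integral_mul_norm_le_Lp_mul_Lq (μ := μ) (f := f) (g := g) (p := 2) (q := 2)
    Real.HolderConjugate.two_two (by simpa using hf) (by simpa using hg)
  simpa [normL2, Real.sqrt_eq_rpow] using h

lemma setIntegral_openI_sq_le {ψ ψ' : ℝ → ℝ} (h : ∀ t, HasDerivAt ψ (ψ' t) t)
    (hc : Continuous ψ') (h0 : ψ (-1 / 2) = 0) :
    ∫ t in openI, ψ t ^ 2 ≤ ∫ t in openI, ψ' t ^ 2 := by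
  have hvol : volume.real openI = 1 := by rw [openI, Real.volume_real_Ioo]; norm_num
  have hfin : volume openI ≠ ⊤ := by rw [openI, Real.volume_Ioo]; exact ENNReal.ofReal_ne_top
  have hi : ∀ f : ℝ → ℝ, Continuous f → IntegrableOn f openI := fun f hf =>
    integrableOn_of_continuous_of_isBounded hf (Metric.isBounded_Ioo _ _)
  have hψc : Continuous ψ := continuous_iff_continuousAt.2 fun t => (h t).continuousAt
  set a := ∫ t in openI, |ψ' t|
  have hpt : ∀ t ∈ openI, |ψ t| ≤ a := by
    intro t ht
    have h1 := intervalIntegral.integral_eq_sub_of_hasDerivAt (a := -1 / 2) (b := t)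
      (fun t _ => h t) (hc.intervalIntegrable _ _)
    rw [h0, sub_zero, intervalIntegral.integral_of_le ht.1.le] at h1
    rw [← h1]
    refine (norm_integral_le_integral_norm (fun t => ψ' t)).trans ?_
    refine setIntegral_mono_set (hi _ hc.abs) (Filter.Eventually.of_forall fun _ => abs_nonneg _) ?_
    exact Filter.Eventually.of_forall fun x hx => ⟨hx.1, hx.2.trans_lt ht.2⟩
  have ha : a ^ 2 ≤ ∫ t in openI, ψ' t ^ 2 := by
    have h1 : 0 ≤ ∫ t in openI, (|ψ' t| - a) ^ 2 := integral_nonneg fun _ => sq_nonneg _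
    have h2 : ∫ t in openI, (|ψ' t| - a) ^ 2 =
        (∫ t in openI, ψ' t ^ 2) - 2 * a * a + a ^ 2 := by
      have h3 : ∀ t, (|ψ' t| - a) ^ 2 = ψ' t ^ 2 - 2 * a * |ψ' t| + a ^ 2 := fun t => by
        rw [← sq_abs (ψ' t)]; ring
      simp_rw [h3]
      rw [integral_add, integral_sub, integral_const_mul, setIntegral_const, hvol, one_smul]
      · exact hi _ (by fun_prop)
      · exact hi _ (by fun_prop)
      · exact hi _ (by fun_prop)
      · exact hi _ (by fun_prop)
    nlinarith
  calc ∫ t in openI, ψ t ^ 2 ≤ ∫ _ in openI, a ^ 2 := by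
        refine setIntegral_mono_on (hi _ (by fun_prop)) (hi _ (by fun_prop)) measurableSet_Ioo ?_
        intro t ht
        rw [← sq_abs]
        have := hpt t ht
        gcongr
    _ = a ^ 2 := by rw [setIntegral_const, hvol, one_smul]
    _ ≤ _ := ha

lemma IsLipschitzDomain.isBounded_rod (hQ : IsLipschitzDomain Q) (ε : ℝ) :
    Bornology.IsBounded (rod Q ε) := (Metric.isBounded_Ioo _ _).prod (hQ.2.2.1.smul₀ ε)

lemma IsLipschitzDomain.measurableSet_rod (hQ : IsLipschitzDomain Q) (ε : ℝ) :
    MeasurableSet (rod Q ε) := measurableSet_Ioo.prod (hQ.1.measurableSet.const_smul₀ ε)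

/-- Friedrichs' inequality on the rod: the length of the rod in the direction `x₁` is `1`. -/
lemma normL2_rod_le_normL2Vec_grad (hQ : IsLipschitzDomain Q) {ε : ℝ} {φ : Space n → ℝ}
    (hφ : ContDiff ℝ 1 φ) (h0 : ∀ x ∈ rodEnds Q ε, φ x = 0) :
    normL2 (volume.restrict (rod Q ε)) φ ≤ normL2Vec (volume.restrict (rod Q ε)) (grad φ) := by
  refine Real.sqrt_le_sqrt ?_
  have hfd := hφ.continuous_fderiv one_ne_zero
  have hi : ∀ f : Space n → ℝ, Continuous f → IntegrableOn f (rod Q ε) := fun f hf =>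
    integrableOn_of_continuous_of_isBounded hf (hQ.isBounded_rod ε)
  have h1 : ∫ x in rod Q ε, φ x ^ 2 ≤ ∫ x in rod Q ε, fderiv ℝ φ x (1, 0) ^ 2 := by
    have hi1 := hi (fun x => φ x ^ 2) (hφ.continuous.pow 2)
    have hi2 := hi (fun x => fderiv ℝ φ x (1, 0) ^ 2) (by fun_prop)
    have hμ : (volume.restrict (rod Q ε) : Measure (Space n)) =
        (volume.restrict openI).prod (volume.restrict (ε • Q)) := by
      rw [Measure.prod_restrict]; rfl
    unfold IntegrableOn at hi1 hi2
    rw [hμ] at hi1 hi2 ⊢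
    rw [integral_prod_symm _ hi1, integral_prod_symm _ hi2]
    refine setIntegral_mono_on hi1.integral_prod_right hi2.integral_prod_right
      (hQ.1.measurableSet.const_smul₀ ε) fun y hy => ?_
    refine setIntegral_openI_sq_le (ψ := fun t => φ (t, y))
      (ψ' := fun t => fderiv ℝ φ (t, y) (1, 0)) (fun t => ?_) (by fun_prop)
      (h0 _ ⟨by simp, hy⟩)
    exact (hφ.differentiable one_ne_zero (t, y)).hasFDerivAt.comp_hasDerivAt t
      ((hasDerivAt_id t).prodMk (hasDerivAt_const t y))
  refine h1.trans (integral_mono (hi _ (by fun_prop)) (hi _ (continuous_sqLen_grad hφ)) ?_)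
  intro x
  simp only [sqLen_grad]
  exact le_add_of_nonneg_right (Finset.sum_nonneg fun _ _ => sq_nonneg _)

/-- The representative in the periodicity cell of a point of `ℝ × ℝ^(d-1)` modulo integer shifts
of the first coordinate. -/
noncomputable def wrap (y : Space n) : Space n := (Int.fract (y.1 + 1 / 2) - 1 / 2, y.2)

lemma measurable_wrap : Measurable (wrap : Space n → Space n) :=
  ((measurable_fst.add_const _).fract.sub_const _).prodMk measurable_snd

lemma wrap_add_of_mem {y : Space n} (hy : y.1 ∈ Ico (-1 / 2 : ℝ) (1 / 2)) (k : ℤ) :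
    wrap (((k : ℝ), 0) + y) = y := by
  have h : Int.fract ((k : ℝ) + y.1 + 1 / 2) = y.1 + 1 / 2 := by
    rw [add_assoc, Int.fract_intCast_add, Int.fract_eq_self]
    constructor <;> linarith [hy.1, hy.2]
  ext
  · simp only [wrap, Prod.fst_add, h]; ring
  · simp [wrap]

/-- The oscillating weight on the rod minus its local cell mean. -/
noncomputable def rodDeviation (Q : Set (Cross n)) (H : ℝ × Space n → ℝ) (ε : ℝ) (x : Space n) :
    ℝ := H (x.1, wrap (ε⁻¹ • x)) - cellMean Q H x.1

variable {H : ℝ × Space n → ℝ} {M L : ℝ}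

lemma IsSlowDensity.measurable_comp_wrap (hH : IsSlowDensity Q H M L) (ε : ℝ) :
    Measurable fun x : Space n => H (x.1, wrap (ε⁻¹ • x)) :=
  hH.measurable.comp (measurable_fst.prodMk (measurable_wrap.comp (measurable_const_smul _)))

lemma IsSlowDensity.measurable_rodDeviation (hH : IsSlowDensity Q H M L) (ε : ℝ) :
    Measurable (rodDeviation Q H ε) :=
  (hH.measurable_comp_wrap ε).sub ((measurable_cellMean hH.measurable).comp measurable_fst)

lemma IsSlowDensity.abs_rodDeviation_le (hH : IsSlowDensity Q H M L) (ε : ℝ) (x : Space n) :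
    |rodDeviation Q H ε x| ≤ 2 * M := by
  have h1 := hH.abs_le (x.1, wrap (ε⁻¹ • x))
  have h2 := abs_cellMean_le (Q := Q) hH.bound_nonneg hH.abs_le x.1
  exact (abs_sub _ _).trans (by linarith)

/-- The estimate for smooth functions vanishing at the ends of the rod: the cell estimates are
summed over all cells, and Friedrichs' inequality turns `‖φ‖²` into `‖φ‖ ‖∇φ‖`. -/
theorem IsSlowDensity.exists_abs_integral_rod_le
    (hH : IsSlowDensity Q H M L) (hQ : IsLipschitzDomain Q) :
    ∃ C : ℝ, 0 ≤ C ∧ ∀ (N : ℕ) (ε : ℝ), ε = 1 / (2 * (N : ℝ) + 1) →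
      ∀ φ : Space n → ℝ, ContDiff ℝ 1 φ → (∀ x ∈ rodEnds Q ε, φ x = 0) →
        |∫ x in rod Q ε, rodDeviation Q H ε x * φ x ^ 2| ≤
          C * (ε * normL2 (volume.restrict (rod Q ε)) φ *
            normL2Vec (volume.restrict (rod Q ε)) (grad φ)) := by
  obtain ⟨C, hC0, hC⟩ := hH.exists_abs_integral_cell_le hQ
  refine ⟨C * (2 * Real.sqrt 2 + 1), by positivity, fun N ε hε φ hφ h0 => ?_⟩
  have hε0 : 0 < ε := by rw [hε]; positivity
  have hεinv : ε * (2 * (N : ℝ) + 1) = 1 := by rw [hε]; field_simp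
  have hfd := hφ.continuous_fderiv one_ne_zero
  have hi : ∀ f : Space n → ℝ, Continuous f → IntegrableOn f (rod Q ε) := fun f hf =>
    integrableOn_of_continuous_of_isBounded hf (hQ.isBounded_rod ε)
  set ρ : Space n → ℝ := rodDeviation Q H ε with hρ
  have hρi : IntegrableOn (fun x => ρ x * φ x ^ 2) (rod Q ε) :=
    Integrable.bdd_mul (hi _ (hφ.continuous.pow 2))
      (hH.measurable_rodDeviation ε).aestronglyMeasurable (c := 2 * M)
      (Filter.Eventually.of_forall (hH.abs_rodDeviation_le ε))
  have hi1 := hi (fun x => |φ x| * ‖fderiv ℝ φ x‖) (hφ.continuous.abs.mul hfd.norm)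
  have hi2 := hi (fun x => φ x ^ 2) (hφ.continuous.pow 2)
  have hcell : ∀ k ∈ Finset.range (2 * N + 1),
      |∫ y in openCell Q, (fun x => ρ x * φ x ^ 2) (ε • ((((k : ℝ) - N, 0) : Space n) + y))| ≤
        C * (2 * ε * (∫ y in openCell Q, (fun x => |φ x| * ‖fderiv ℝ φ x‖)
            (ε • ((((k : ℝ) - N, 0) : Space n) + y))) +
          ε * ∫ y in openCell Q, (fun x => φ x ^ 2)
            (ε • ((((k : ℝ) - N, 0) : Space n) + y))) := by
    intro k hk
    have hk' : (k : ℝ) ≤ 2 * N := by exact_mod_cast Nat.lt_succ_iff.1 (Finset.mem_range.1 hk)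
    have hk0 : (0 : ℝ) ≤ k := k.cast_nonneg
    set c : Space n := ((k : ℝ) - N, 0) with hc
    set u : Space n → ℝ := fun y => φ (ε • (c + y)) ^ 2 with hu
    have hshift : ∀ y, HasFDerivAt (fun y : Space n => ε • (c + y))
        (ε • ContinuousLinearMap.id ℝ (Space n)) y := fun y =>
      ((hasFDerivAt_id y).const_add c).const_smul ε
    have huC : ContDiff ℝ 1 u := (hφ.comp (by fun_prop)).pow 2
    have hdu : ∀ y, ‖fderiv ℝ u y‖ ≤
        2 * ε * (|φ (ε • (c + y))| * ‖fderiv ℝ φ (ε • (c + y))‖) := by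
      intro y
      have h1 : HasFDerivAt u ((2 * φ (ε • (c + y))) • (ε • fderiv ℝ φ (ε • (c + y)))) y := by
        have h2 := ((hφ.differentiable one_ne_zero (ε • (c + y))).hasFDerivAt.comp y
          (hshift y)).pow 2
        refine (h2 : HasFDerivAt u _ y).congr_fderiv ?_
        simp only [ContinuousLinearMap.comp_smul, ContinuousLinearMap.comp_id,
          Function.comp_apply, Nat.add_one_sub_one, pow_one, nsmul_eq_mul, Nat.cast_ofNat]
      rw [h1.fderiv, norm_smul, norm_smul, norm_mul, Real.norm_of_nonneg hε0.le,
        Real.norm_eq_abs, Real.norm_eq_abs, abs_two]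
      exact le_of_eq (by ring)
    have ht : ε * ((k : ℝ) - N) ∈ openI := by
      constructor <;> nlinarith
    have hcell := hC (ε * ((k : ℝ) - N)) ht ε hε0 (fun y => ε * ((k : ℝ) - N + y.1)) (by fun_prop)
      (by
        rintro y ⟨⟨hy1, hy2⟩, -⟩
        refine ⟨by constructor <;> nlinarith, ?_⟩
        rw [← mul_sub, abs_mul, abs_of_pos hε0, add_sub_cancel_left]
        have : |y.1| ≤ 1 := _root_.abs_le.2 ⟨by linarith, by linarith⟩
        nlinarith) u huC (fun y => sq_nonneg _)
    have heq : ∫ y in openCell Q, (fun x => ρ x * φ x ^ 2) (ε • (c + y)) =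
        ∫ y in openCell Q, (H (ε * ((k : ℝ) - N + y.1), y) -
          cellMean Q H (ε * ((k : ℝ) - N + y.1))) * u y := by
      refine setIntegral_congr_fun hQ.isOpen_openCell.measurableSet fun y hy => ?_
      have hw : wrap (c + y) = y := by
        have := wrap_add_of_mem (y := y) (Ioo_subset_Ico_self hy.1) ((k : ℤ) - N)
        simpa [hc] using this
      simp only [hρ, rodDeviation, hu, inv_smul_smul₀ hε0.ne', hw]
      rfl
    rw [heq]
    refine hcell.trans ?_
    gcongr
    rw [← integral_const_mul]
    have hib : ∀ f : Space n → ℝ, Continuous f → IntegrableOn f (openCell Q) := fun f hf =>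
      integrableOn_of_continuous_of_isBounded hf hQ.isBounded_openCell
    refine integral_mono (hib _ (huC.continuous_fderiv one_ne_zero).norm) (hib _ ?_) hdu
    have hcφ := hφ.continuous
    fun_prop
  have hsum : |∫ x in rod Q ε, ρ x * φ x ^ 2| ≤
      C * (2 * ε * (∫ x in rod Q ε, |φ x| * ‖fderiv ℝ φ x‖) + ε * ∫ x in rod Q ε, φ x ^ 2) := by
    rw [setIntegral_rod_eq_sum hQ N hε hρi, setIntegral_rod_eq_sum hQ N hε hi1,
      setIntegral_rod_eq_sum hQ N hε hi2, abs_mul, abs_of_pos (pow_pos hε0 _)]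
    calc _ ≤ ε ^ (n + 1) * ∑ k ∈ Finset.range (2 * N + 1), _ := by
          gcongr
          exact (Finset.abs_sum_le_sum_abs _ _).trans (Finset.sum_le_sum hcell)
      _ = _ := by
          rw [← Finset.mul_sum, Finset.sum_add_distrib, ← Finset.mul_sum, ← Finset.mul_sum]
          ring
  set μ : Measure (Space n) := volume.restrict (rod Q ε)
  have hmem : ∀ f : Space n → ℝ, Continuous f → MemLp f 2 μ := fun f hf =>
    (memLp_two_iff_integrable_sq hf.aestronglyMeasurable).2 (hi _ (hf.pow 2))
  have hA : ∫ x, |φ x| * ‖fderiv ℝ φ x‖ ∂μ ≤ normL2 μ φ * (Real.sqrt 2 * normL2Vec μ (grad φ)) := by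
    have h1 := integral_abs_mul_abs_le_normL2_mul (hmem φ hφ.continuous) (hmem _ hfd.norm)
    simp only [abs_norm] at h1
    refine h1.trans (mul_le_mul_of_nonneg_left ?_ (normL2_nonneg _ _))
    rw [normL2, normL2Vec, ← Real.sqrt_mul zero_le_two, ← integral_const_mul]
    refine Real.sqrt_le_sqrt (integral_mono (hi _ (hfd.norm.pow 2))
      ((hi _ (continuous_sqLen_grad hφ)).const_mul 2) fun x => sq_norm_fderiv_le φ x)
  have hB : ∫ x, φ x ^ 2 ∂μ ≤ normL2 μ φ * normL2Vec μ (grad φ) := by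
    rw [← sq_normL2, sq]
    exact mul_le_mul_of_nonneg_left (normL2_rod_le_normL2Vec_grad hQ hφ h0) (normL2_nonneg _ _)
  refine hsum.trans ?_
  rw [mul_assoc C]
  gcongr
  calc _ ≤ 2 * ε * (normL2 μ φ * (Real.sqrt 2 * normL2Vec μ (grad φ))) +
        ε * (normL2 μ φ * normL2Vec μ (grad φ)) := by gcongr
    _ = _ := by ring

end Rod

/-! ### Passage to Sobolev functions, and rescaling -/

section Limit

variable {n : ℕ} {μ : Measure (Space n)}

lemma normL2_mono {f g : Space n → ℝ} (hg : MemLp g 2 μ) (h : ∀ x, |f x| ≤ |g x|) :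
    normL2 μ f ≤ normL2 μ g := by
  refine Real.sqrt_le_sqrt (integral_mono_of_nonneg (Filter.Eventually.of_forall fun _ =>
    sq_nonneg _) hg.integrable_sq (Filter.Eventually.of_forall fun x => ?_))
  exact sq_le_sq.2 (h x)

lemma normL2_add_le {f g : Space n → ℝ} (hf : MemLp f 2 μ) (hg : MemLp g 2 μ) :
    normL2 μ (fun x => f x + g x) ≤ normL2 μ f + normL2 μ g := by
  have hfg : Integrable (fun x => |f x| * |g x|) μ := hf.abs.integrable_mul hg.abs
  have hs : Integrable (fun x => f x ^ 2 + 2 * (|f x| * |g x|)) μ :=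
    hf.integrable_sq.add (hfg.const_mul 2)
  refine Real.sqrt_le_iff.2 ⟨add_nonneg (normL2_nonneg _ _) (normL2_nonneg _ _), ?_⟩
  calc ∫ x, (f x + g x) ^ 2 ∂μ ≤ ∫ x, (f x ^ 2 + 2 * (|f x| * |g x|) + g x ^ 2) ∂μ := by
        refine integral_mono (hf.add hg).integrable_sq
          (hs.add hg.integrable_sq) fun x => ?_
        have := le_abs_self (f x * g x)
        rw [abs_mul] at this
        nlinarith
    _ = normL2 μ f ^ 2 + 2 * ∫ x, |f x| * |g x| ∂μ + normL2 μ g ^ 2 := by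
        rw [integral_add hs hg.integrable_sq,
          integral_add hf.integrable_sq (hfg.const_mul 2), integral_const_mul, sq_normL2, sq_normL2]
    _ ≤ _ := by nlinarith [integral_abs_mul_abs_le_normL2_mul hf hg]

lemma sqrt_sqLen_eq_norm (a : Space n) : Real.sqrt (sqLen a) = ‖WithLp.toLp 2 a‖ := by
  rw [WithLp.prod_norm_eq_of_L2]
  simp [sqLen]

lemma normL2Vec_eq_normL2 (g : Space n → Space n) :
    normL2Vec μ g = normL2 μ fun x => Real.sqrt (sqLen (g x)) := by
  simp only [normL2Vec, normL2, Real.sq_sqrt (sqLen_nonneg _)]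

lemma memLp_sqrt_sqLen {g : Space n → Space n} (hg : MemLp g 2 μ) :
    MemLp (fun x => Real.sqrt (sqLen (g x))) 2 μ := by
  have hc : Continuous fun a : Space n => Real.sqrt (sqLen a) := by unfold sqLen; fun_prop
  refine hg.of_le_mul (c := 2) (hc.comp_aestronglyMeasurable hg.1)
    (Filter.Eventually.of_forall fun x => ?_)
  rw [Real.norm_of_nonneg (Real.sqrt_nonneg _)]
  refine Real.sqrt_le_iff.2 ⟨by positivity, ?_⟩
  have h1 := norm_fst_le (g x)
  have h2 := norm_snd_le (g x)
  rw [sqLen, ← sq_abs, ← Real.norm_eq_abs]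
  nlinarith [norm_nonneg (g x).1, norm_nonneg (g x).2]

lemma memLp_grad [IsFiniteMeasure μ] {φ : Space n → ℝ} (hφ : ContDiff ℝ 1 φ)
    (hs : HasCompactSupport φ) : MemLp (grad φ) 2 μ := by
  set T : (Space n →L[ℝ] ℝ) → Space n := fun D =>
    (D (1, 0), WithLp.toLp 2 fun i => D (0, EuclideanSpace.single i 1)) with hT
  have hTc : Continuous T := by fun_prop
  have hT0 : T 0 = 0 := by simp only [hT, zero_apply]; rfl
  have hc : Continuous (grad φ) := hTc.comp (hφ.continuous_fderiv one_ne_zero)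
  exact hc.memLp_of_hasCompactSupport ((hs.fderiv ℝ).comp_left hT0)

/-- A quadratic estimate with a bounded weight passes from smooth functions to their limits in the
Sobolev space. -/
lemma InSobolevVanishing.abs_integral_mul_sq_le [IsFiniteMeasure μ] {Γ : Set (Space n)}
    {ρ : Space n → ℝ} {M C : ℝ} (hρ : Measurable ρ) (hM : ∀ x, |ρ x| ≤ M) (hC : 0 ≤ C)
    (h : ∀ φ : Space n → ℝ, ContDiff ℝ ∞ φ → (∀ x ∈ Γ, φ x = 0) →
      |∫ x, ρ x * φ x ^ 2 ∂μ| ≤ C * (normL2 μ φ * normL2Vec μ (grad φ)))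
    {v : Space n → ℝ} {g : Space n → Space n} (hv : InSobolevVanishing μ Γ v g) :
    |∫ x, ρ x * v x ^ 2 ∂μ| ≤ C * (normL2 μ v * normL2Vec μ g) := by
  obtain ⟨hv2, hg2, happ⟩ := hv
  have hM0 : 0 ≤ M := (abs_nonneg _).trans (hM 0)
  have key : ∀ η > 0, |∫ x, ρ x * v x ^ 2 ∂μ| ≤ C * ((normL2 μ v + η) * (normL2Vec μ g + η)) +
      M * (2 * (η * normL2 μ v) + η ^ 2) := by
    intro η hη
    obtain ⟨φ, hφ, hφs, hφ0, hd, he⟩ := happ η hη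
    have hφ1 : ContDiff ℝ 1 φ := hφ.of_le (by exact_mod_cast le_top)
    have hφ2 : MemLp φ 2 μ := hφ.continuous.memLp_of_hasCompactSupport hφs
    have hgφ : MemLp (fun x => g x - grad φ x) 2 μ := hg2.sub (memLp_grad hφ1 hφs)
    have hvφ : MemLp (fun x => v x - φ x) 2 μ := hv2.sub hφ2
    have h1 : normL2 μ φ ≤ normL2 μ v + η := by
      have h2 : MemLp (fun x => φ x - v x) 2 μ := hφ2.sub hv2
      have h3 := normL2_add_le hv2 h2
      have h4 : normL2 μ (fun x => φ x - v x) = normL2 μ fun x => v x - φ x := by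
        simp only [normL2, sub_sq_comm]
      simp only [add_sub_cancel] at h3
      linarith
    have h2 : normL2Vec μ (grad φ) ≤ normL2Vec μ g + η := by
      rw [normL2Vec_eq_normL2] at he ⊢
      rw [normL2Vec_eq_normL2]
      have h3 := normL2_add_le (memLp_sqrt_sqLen hg2) (memLp_sqrt_sqLen hgφ)
      refine le_trans (normL2_mono ((memLp_sqrt_sqLen hg2).add (memLp_sqrt_sqLen hgφ))
        fun x => ?_) (h3.trans (by linarith))
      rw [abs_of_nonneg (Real.sqrt_nonneg _)]
      refine le_trans ?_ (le_abs_self _)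
      simp only [Pi.add_apply, sqrt_sqLen_eq_norm]
      have : WithLp.toLp 2 (grad φ x) = WithLp.toLp 2 (g x) - WithLp.toLp 2 (g x - grad φ x) := by
        rw [← WithLp.toLp_sub, sub_sub_cancel]
      rw [this]
      exact norm_sub_le _ _
    have hint : ∀ f : Space n → ℝ, MemLp f 2 μ → Integrable (fun x => ρ x * f x ^ 2) μ :=
      fun f hf => hf.integrable_sq.bdd_mul hρ.aestronglyMeasurable
        (Filter.Eventually.of_forall hM)
    have hprod : Integrable (fun x => |v x - φ x| * |v x|) μ := hvφ.abs.integrable_mul hv2.abs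
    have h3 : |∫ x, ρ x * v x ^ 2 ∂μ - ∫ x, ρ x * φ x ^ 2 ∂μ| ≤
        M * (2 * (η * normL2 μ v) + η ^ 2) := by
      rw [← integral_sub (hint v hv2) (hint φ hφ2)]
      calc _ ≤ ∫ x, M * (2 * (|v x - φ x| * |v x|) + (v x - φ x) ^ 2) ∂μ := by
            refine norm_integral_le_of_norm_le (f := fun x => ρ x * v x ^ 2 - ρ x * φ x ^ 2)
              (((hprod.const_mul 2).add hvφ.integrable_sq).const_mul M)
              (Filter.Eventually.of_forall fun x => ?_)
            rw [← mul_sub, norm_mul, Real.norm_eq_abs, Real.norm_eq_abs]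
            refine mul_le_mul (hM x) ?_ (abs_nonneg _) hM0
            rw [show v x ^ 2 - φ x ^ 2 = 2 * ((v x - φ x) * v x) - (v x - φ x) ^ 2 by ring]
            refine (abs_sub _ _).trans (le_of_eq ?_)
            rw [abs_mul, abs_mul, abs_two, abs_of_nonneg (sq_nonneg (v x - φ x))]
        _ = M * (2 * (∫ x, |v x - φ x| * |v x| ∂μ) + normL2 μ (fun x => v x - φ x) ^ 2) := by
            rw [integral_const_mul, integral_add (hprod.const_mul 2) hvφ.integrable_sq,
              integral_const_mul, sq_normL2]
        _ ≤ _ := by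
            have h5 := integral_abs_mul_abs_le_normL2_mul hvφ hv2
            have h6 := normL2_nonneg μ fun x => v x - φ x
            have h7 := normL2_nonneg μ v
            gcongr
            exact h5.trans (by gcongr)
    calc |∫ x, ρ x * v x ^ 2 ∂μ| = |∫ x, ρ x * φ x ^ 2 ∂μ +
          (∫ x, ρ x * v x ^ 2 ∂μ - ∫ x, ρ x * φ x ^ 2 ∂μ)| := by rw [add_sub_cancel]
      _ ≤ _ := abs_add_le _ _
      _ ≤ _ := by
          refine add_le_add ((h φ hφ hφ0).trans ?_) h3
          have h5 := normL2Vec_nonneg μ (grad φ)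
          have h6 := normL2_nonneg μ v
          gcongr
  have hcont : Continuous fun η : ℝ => C * ((normL2 μ v + η) * (normL2Vec μ g + η)) +
      M * (2 * (η * normL2 μ v) + η ^ 2) := by fun_prop
  have hlim := (hcont.tendsto 0).mono_left (nhdsWithin_le_nhds (s := Ioi 0))
  simp only [add_zero, zero_mul, mul_zero, ne_eq, OfNat.ofNat_ne_zero, not_false_eq_true,
    zero_pow] at hlim
  exact ge_of_tendsto hlim (by filter_upwards [self_mem_nhdsWithin] with η hη using key η hη)

end Limit

section Identification

variable {n : ℕ} {Q : Set (Cross n)} {α : ℝ} {F w : ℝ → Space n → ℝ}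

lemma apply_wrap {β : Type*} {f : Space n → β} {y : Space n}
    (h : ∀ t : ℝ, f (t + 1, y.2) = f (t, y.2)) : f (wrap y) = f y := by
  have hp : Function.Periodic (fun t : ℝ => f (t, y.2)) 1 := h
  have h1 := hp.sub_zsmul_eq ⌊y.1 + 1 / 2⌋ (x := y.1)
  simp only [zsmul_eq_mul, mul_one] at h1
  have h2 : wrap y = (y.1 - ⌊y.1 + 1 / 2⌋, y.2) := by
    ext
    · simp only [wrap, Int.fract]; ring
    · rfl
  rw [h2, h1]

lemma wrap_mem_cell {y : Space n} (hy : y.2 ∈ Q) : wrap y ∈ cell Q := by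
  refine ⟨⟨?_, ?_⟩, hy⟩
  · have := Int.fract_nonneg (y.1 + 1 / 2)
    simp only [wrap]; linarith
  · have := Int.fract_lt_one (y.1 + 1 / 2)
    simp only [wrap]; linarith

lemma IsPerforation.cellDensity_wrap (hF : IsPerforation Q α F) (hw : IsC1HolderWeight Q α w)
    {s : ℝ} (hs : s ∈ openI) {y : Space n} (hy : y.2 ∈ Q) :
    cellDensity Q F w (s, wrap y) = indicator {y | 0 < F s y} (w s) y := by
  have hsc := openI_subset_closedI hs
  have hFw : F s (wrap y) = F s y := apply_wrap fun t => hF.2.1 s hsc t _ (subset_closure hy)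
  have hww : w s (wrap y) = w s y := apply_wrap fun t => hw.1 s hsc t _ (subset_closure hy)
  by_cases hpos : 0 < F s y
  · rw [cellDensity_of_pos hs (wrap_mem_cell hy) (hFw ▸ hpos), hww]
    exact (indicator_of_mem (s := {y | 0 < F s y}) hpos _).symm
  · rw [cellDensity_of_not_pos (by rwa [hFw])]
    exact (indicator_of_notMem (s := {y | 0 < F s y}) hpos _).symm

lemma IsPerforation.cellMean_cellDensity (hF : IsPerforation Q α F) (hQ : IsLipschitzDomain Q)
    {s : ℝ} (hs : s ∈ openI) :
    cellMean Q (cellDensity Q F w) s =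
      (volume.real (cell Q))⁻¹ * ∫ y in perforatedCell Q F s, w s y := by
  have hcm : MeasurableSet (cell Q) := measurableSet_Ico.prod hQ.1.measurableSet
  have hYm : MeasurableSet (perforatedCell Q F s) := by
    have := measurable_prodMk_left (x := s) (hF.measurableSet_pos hQ)
    convert this using 1
    ext y
    exact ⟨fun h => ⟨⟨hs, h.1⟩, h.2⟩, fun h => ⟨h.1.2, h.2⟩⟩
  rw [cellMean, measureReal_congr openCell_ae_eq_cell, setIntegral_congr_set openCell_ae_eq_cell]
  congr 1
  have hsub : perforatedCell Q F s ⊆ cell Q := sep_subset _ _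
  rw [← inter_eq_right.2 hsub, ← setIntegral_indicator hYm]
  refine setIntegral_congr_fun hcm fun y hy => ?_
  by_cases hpos : 0 < F s y
  · rw [indicator_of_mem (show y ∈ perforatedCell Q F s from ⟨hy, hpos⟩)]
    exact cellDensity_of_pos hs hy hpos
  · rw [indicator_of_notMem (show y ∉ perforatedCell Q F s from fun h => hpos h.2)]
    exact cellDensity_of_not_pos hpos

lemma IsPerforation.exists_isSlowDensity (hF : IsPerforation Q α F) (hα : 0 < α)
    (hQ : IsLipschitzDomain Q) (hw : IsC1HolderWeight Q α w) :
    ∃ M L : ℝ, IsSlowDensity Q (cellDensity Q F w) M L := by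
  obtain ⟨M, hM, hb⟩ := hw.exists_cellDensity_bound (F := F) hα
  obtain ⟨L, hL, hl⟩ := hF.exists_lintegral_cellDensity_sub_le hα hQ hw
  exact ⟨M, L, hF.measurable_cellDensity hα hQ hw, hM, hb, hL, hl⟩

/-- Integrals against the rescaled measure are integrals over the rod of thickness `ε`, up to a
nonnegative factor. -/
lemma exists_integral_rodMeasure_eq (Q : Set (Cross n)) {ε : ℝ} (hε : 0 < ε) :
    ∃ κ : ℝ, 0 ≤ κ ∧ ∀ f : Space n → ℝ,
      ∫ z, f z ∂(rodMeasure Q ε) = κ * ∫ x in rod Q ε, f (ε ^ (-(1 / 4) : ℝ) • x) := by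
  have hl : 0 < ε ^ (-(1 / 4) : ℝ) := Real.rpow_pos_of_pos hε _
  have hk : 0 ≤ ε ^ (-(3 / 4 * n) : ℝ) / volume.real Q := by positivity
  refine ⟨ε ^ (-(3 / 4 * n) : ℝ) / volume.real Q *
    (ε ^ (-(1 / 4) : ℝ)) ^ Module.finrank ℝ (Space n), by positivity, fun f => ?_⟩
  rw [rodMeasure, integral_smul_measure, ENNReal.toReal_ofReal hk,
    Measure.setIntegral_comp_smul_of_pos volume f _ hl, smul_eq_mul, smul_eq_mul]
  field_simp

lemma isFiniteMeasure_rod (hQ : IsLipschitzDomain Q) (ε : ℝ) :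
    IsFiniteMeasure (volume.restrict (rod Q ε)) :=
  ⟨by rw [Measure.restrict_apply_univ]; exact (hQ.isBounded_rod ε).measure_lt_top⟩

lemma isFiniteMeasure_rodMeasure (hQ : IsLipschitzDomain Q) (ε : ℝ) :
    IsFiniteMeasure (rodMeasure Q ε) := by
  have : IsFiniteMeasure (volume.restrict (ε ^ (-(1 / 4) : ℝ) • rod Q ε)) :=
    ⟨by
      rw [Measure.restrict_apply_univ]
      exact ((hQ.isBounded_rod ε).smul₀ (ε ^ (-(1 / 4) : ℝ))).measure_lt_top⟩
  exact Measure.smul_finite _ ENNReal.ofReal_ne_top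

/-- The estimate for smooth functions on the rescaled rod. -/
lemma abs_integral_rodMeasure_le {ε C : ℝ} (hε : 0 < ε)
    {ρ : Space n → ℝ}
    (h : ∀ φ : Space n → ℝ, ContDiff ℝ 1 φ → (∀ x ∈ rodEnds Q ε, φ x = 0) →
      |∫ x in rod Q ε, ρ x * φ x ^ 2| ≤ C * (ε * normL2 (volume.restrict (rod Q ε)) φ *
        normL2Vec (volume.restrict (rod Q ε)) (grad φ)))
    {φ : Space n → ℝ} (hφ : ContDiff ℝ 1 φ)
    (h0 : ∀ z ∈ ε ^ (-(1 / 4) : ℝ) • rodEnds Q ε, φ z = 0) :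
    |∫ z, ρ (ε ^ (1 / 4 : ℝ) • z) * φ z ^ 2 ∂(rodMeasure Q ε)| ≤
      C * (ε ^ (3 / 4 : ℝ) * normL2 (rodMeasure Q ε) φ * normL2Vec (rodMeasure Q ε) (grad φ)) := by
  set l := ε ^ (-(1 / 4) : ℝ) with hl_def
  have hl : 0 < l := Real.rpow_pos_of_pos hε _
  have hll : ε ^ (1 / 4 : ℝ) * l = 1 := by
    rw [hl_def, ← Real.rpow_add hε]; norm_num
  have hεl : ε ^ (3 / 4 : ℝ) = ε * l := by
    rw [hl_def]; nth_rw 2 [← Real.rpow_one ε]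
    rw [← Real.rpow_add hε]; norm_num
  obtain ⟨κ, hκ, hint⟩ := exists_integral_rodMeasure_eq Q hε
  rw [← hl_def] at hint
  set ψ : Space n → ℝ := fun x => φ (l • x) with hψ
  have hψC : ContDiff ℝ 1 ψ := hφ.comp (by fun_prop)
  have hψ0 : ∀ x ∈ rodEnds Q ε, ψ x = 0 := fun x hx => h0 _ (smul_mem_smul_set hx)
  have hgrad : ∀ x, sqLen (grad ψ x) = l ^ 2 * sqLen (grad φ (l • x)) := by
    intro x
    have h1 : fderiv ℝ ψ x = l • fderiv ℝ φ (l • x) := by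
      have h2 := (hφ.differentiable one_ne_zero (l • x)).hasFDerivAt.comp x
        ((hasFDerivAt_id (𝕜 := ℝ) x).const_smul l)
      rw [ContinuousLinearMap.comp_smul] at h2
      exact h2.fderiv
    rw [sqLen_grad, sqLen_grad, h1]
    simp only [smul_apply, smul_eq_mul, mul_pow, ← Finset.mul_sum]
    ring
  have hN : normL2 (rodMeasure Q ε) φ =
      Real.sqrt κ * normL2 (volume.restrict (rod Q ε)) ψ := by
    rw [normL2, hint, Real.sqrt_mul hκ]; rfl
  have hG : normL2Vec (volume.restrict (rod Q ε)) (grad ψ) =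
      l * Real.sqrt (∫ x in rod Q ε, sqLen (grad φ (l • x))) := by
    simp_rw [normL2Vec, hgrad]
    rw [integral_const_mul, Real.sqrt_mul (by positivity), Real.sqrt_sq hl.le]
  have hG' : normL2Vec (rodMeasure Q ε) (grad φ) =
      Real.sqrt κ * Real.sqrt (∫ x in rod Q ε, sqLen (grad φ (l • x))) := by
    rw [normL2Vec, hint, Real.sqrt_mul hκ]
  have hE : ∫ z, ρ (ε ^ (1 / 4 : ℝ) • z) * φ z ^ 2 ∂(rodMeasure Q ε) =
      κ * ∫ x in rod Q ε, ρ x * ψ x ^ 2 := by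
    rw [hint]; simp only [smul_smul, hll, one_smul, hψ]
  rw [hE, abs_mul, abs_of_nonneg hκ, hN, hG', hεl]
  have h1 := h ψ hψC hψ0
  rw [hG] at h1
  refine (mul_le_mul_of_nonneg_left h1 hκ).trans (le_of_eq ?_)
  nth_rw 1 [← Real.mul_self_sqrt hκ]
  ring

end Identification

/-! ### The two estimates for the perforated rod -/

section Main

variable {n : ℕ} {Q : Set (Cross n)} {α : ℝ} {F w : ℝ → Space n → ℝ}

lemma inv_smul_snd_mem_of_mem_rod {ε : ℝ} (hε : 0 < ε) {x : Space n} (hx : x ∈ rod Q ε) :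
    (ε⁻¹ • x).2 ∈ Q :=
  (mem_smul_set_iff_inv_smul_mem₀ hε.ne' _ _).1 hx.2

lemma IsPerforation.measurableSet_perforatedRod (hF : IsPerforation Q α F)
    (hQ : IsLipschitzDomain Q) {ε : ℝ} (hε : 0 < ε) : MeasurableSet (perforatedRod Q F ε) := by
  have hg : Measurable fun x : Space n => (x.1, wrap (ε⁻¹ • x)) :=
    measurable_fst.prodMk (measurable_wrap.comp (measurable_const_smul _))
  convert (hQ.measurableSet_rod ε).inter (hg (hF.measurableSet_pos hQ)) using 1
  ext x
  refine and_congr_right fun hx => ?_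
  have hy := inv_smul_snd_mem_of_mem_rod hε hx
  have hFw : F x.1 (wrap (ε⁻¹ • x)) = F x.1 (ε⁻¹ • x) :=
    apply_wrap fun t => hF.2.1 x.1 (openI_subset_closedI hx.1) t _ (subset_closure hy)
  exact ⟨fun h => ⟨⟨hx.1, wrap_mem_cell hy⟩, by simpa only [hFw] using h⟩,
    fun h => by simpa only [hFw] using h.2⟩

lemma IsPerforation.setIntegral_perforatedRod (hF : IsPerforation Q α F)
    (hQ : IsLipschitzDomain Q) (hw : IsC1HolderWeight Q α w) {ε : ℝ} (hε : 0 < ε)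
    (v : Space n → ℝ) :
    ∫ x in perforatedRod Q F ε, w x.1 (ε⁻¹ • x) * v x ^ 2 =
      ∫ x in rod Q ε, cellDensity Q F w (x.1, wrap (ε⁻¹ • x)) * v x ^ 2 := by
  have hsub : perforatedRod Q F ε ⊆ rod Q ε := sep_subset _ _
  rw [← inter_eq_right.2 hsub, ← setIntegral_indicator (hF.measurableSet_perforatedRod hQ hε)]
  refine setIntegral_congr_fun (hQ.measurableSet_rod ε) fun x hx => ?_
  simp only [hF.cellDensity_wrap hw hx.1 (inv_smul_snd_mem_of_mem_rod hε hx)]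
  by_cases hpos : 0 < F x.1 (ε⁻¹ • x)
  · rw [indicator_of_mem (show x ∈ perforatedRod Q F ε from ⟨hx, hpos⟩),
      indicator_of_mem (s := {y | 0 < F x.1 y}) hpos]
  · rw [indicator_of_notMem (show x ∉ perforatedRod Q F ε from fun h => hpos h.2),
      indicator_of_notMem (s := {y | 0 < F x.1 y}) hpos, zero_mul]

lemma volume_real_mul_cellAverage {s : ℝ} (c : ℝ → Space n → ℝ) (hQ : IsLipschitzDomain Q) :
    volume.real (perforatedCell Q F s) * cellAverage Q F c s =
      ∫ y in perforatedCell Q F s, c s y := by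
  have hfin : volume (perforatedCell Q F s) ≠ ⊤ := by
    refine ((measure_mono (sep_subset _ _)).trans_lt (b := volume (cell Q)) ?_).ne
    exact ((Metric.isBounded_Ico _ _).prod hQ.2.2.1).measure_lt_top
  rcases eq_or_ne (volume.real (perforatedCell Q F s)) 0 with h | h
  · -- On a null cell both sides vanish.
    rw [h, zero_mul, Measure.restrict_eq_zero.2 ((measureReal_eq_zero_iff hfin).1 h),
      integral_zero_measure]
  · rw [cellAverage, ← mul_assoc, mul_inv_cancel₀ h, one_mul]

lemma IsSlowDensity.integral_rodDeviation_comp_mul_sq {H : ℝ × Space n → ℝ} {M L : ℝ}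
    (hH : IsSlowDensity Q H M L) {μ : Measure (Space n)} {v : Space n → ℝ} (hv : MemLp v 2 μ)
    {ε : ℝ} {T : Space n → Space n} (hT : Measurable T) :
    ∫ x, rodDeviation Q H ε (T x) * v x ^ 2 ∂μ =
      ∫ x, H ((T x).1, wrap (ε⁻¹ • T x)) * v x ^ 2 ∂μ -
        ∫ x, cellMean Q H (T x).1 * v x ^ 2 ∂μ := by
  rw [← integral_sub]
  · simp only [rodDeviation, sub_mul]
  · exact hv.integrable_sq.bdd_mul ((hH.measurable_comp_wrap ε).comp hT).aestronglyMeasurable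
      (Filter.Eventually.of_forall fun x => hH.abs_le _)
  · exact hv.integrable_sq.bdd_mul
      ((measurable_cellMean hH.measurable).comp (measurable_fst.comp hT)).aestronglyMeasurable
      (Filter.Eventually.of_forall fun x => abs_cellMean_le hH.bound_nonneg hH.abs_le _)

/-- The estimate on the thin rod. It holds for all `N`, so that any threshold `ε₀` will do. -/
theorem exists_rod_estimate (hQ : IsLipschitzDomain Q) (hα : 0 < α) (hF : IsPerforation Q α F)
    (hw : IsC1HolderWeight Q α w) :
    ∃ C ε₀ : ℝ, 0 < ε₀ ∧ ∀ (N : ℕ) (ε : ℝ), ε = 1 / (2 * (N : ℝ) + 1) → ε < ε₀ →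
      ∀ (v : Space n → ℝ) (g : Space n → Space n), InH10Rod Q ε v g →
        |(∫ x in perforatedRod Q F ε, w x.1 (ε⁻¹ • x) * v x ^ 2) -
            (volume.real (cell Q))⁻¹ *
              ∫ x in rod Q ε, (∫ y in perforatedCell Q F x.1, w x.1 y) * v x ^ 2| ≤
          C * (ε * normL2 (volume.restrict (rod Q ε)) v *
            normL2Vec (volume.restrict (rod Q ε)) g) := by
  obtain ⟨M, L, hH⟩ := hF.exists_isSlowDensity hα hQ hw
  obtain ⟨C, hC0, hC⟩ := hH.exists_abs_integral_rod_le hQ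
  refine ⟨C, 1, one_pos, fun N ε hε _ v g hv => ?_⟩
  have hε0 : 0 < ε := by rw [hε]; positivity
  have := isFiniteMeasure_rod hQ ε
  have hmean : (volume.real (cell Q))⁻¹ *
      ∫ x in rod Q ε, (∫ y in perforatedCell Q F x.1, w x.1 y) * v x ^ 2 =
        ∫ x in rod Q ε, cellMean Q (cellDensity Q F w) x.1 * v x ^ 2 := by
    rw [← integral_const_mul]
    refine setIntegral_congr_fun (hQ.measurableSet_rod ε) fun x hx => ?_
    simp only [hF.cellMean_cellDensity hQ hx.1, mul_assoc]
  have hdev := hH.integral_rodDeviation_comp_mul_sq (ε := ε) hv.2.1 measurable_id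
  simp only [id] at hdev
  rw [hF.setIntegral_perforatedRod hQ hw hε0, hmean, ← hdev]
  have h := hv.2.abs_integral_mul_sq_le (C := C * ε) (hH.measurable_rodDeviation ε)
    (hH.abs_rodDeviation_le ε) (by positivity) fun φ hφ hφ0 => by
      refine (hC N ε hε φ (hφ.of_le (by exact_mod_cast le_top)) hφ0).trans (le_of_eq (by ring))
  exact h.trans (le_of_eq (by ring))

/-- The estimate on the rescaled rod. The substitution `z = ε^(-1/4) x` turns the factor `ε` into
`ε * ε^(-1/4) = ε^(3/4)`, the negative power coming from the gradient. -/
theorem exists_rescaled_rod_estimate (hQ : IsLipschitzDomain Q) (hα : 0 < α)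
    (hF : IsPerforation Q α F) (hw : IsC1HolderWeight Q α w) :
    ∃ C ε₀ : ℝ, 0 < ε₀ ∧ ∀ (N : ℕ) (ε : ℝ), ε = 1 / (2 * (N : ℝ) + 1) → ε < ε₀ →
      ∀ (v : Space n → ℝ) (g : Space n → Space n),
        InSobolevVanishing (rodMeasure Q ε) (ε ^ (-(1 / 4) : ℝ) • rodEnds Q ε) v g →
        |(∫ z, Set.indicator {y | 0 < F (ε ^ (1 / 4 : ℝ) * z.1) y} (w (ε ^ (1 / 4 : ℝ) * z.1))
              (ε ^ (-(3 / 4) : ℝ) • z) * v z ^ 2 ∂(rodMeasure Q ε)) -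
            (volume.real (cell Q))⁻¹ *
              ∫ z, volume.real (perforatedCell Q F (ε ^ (1 / 4 : ℝ) * z.1)) *
                cellAverage Q F w (ε ^ (1 / 4 : ℝ) * z.1) * v z ^ 2 ∂(rodMeasure Q ε)| ≤
          C * (ε ^ (3 / 4 : ℝ) * normL2 (rodMeasure Q ε) v *
            normL2Vec (rodMeasure Q ε) g) := by
  obtain ⟨M, L, hH⟩ := hF.exists_isSlowDensity hα hQ hw
  obtain ⟨C, hC0, hC⟩ := hH.exists_abs_integral_rod_le hQ
  refine ⟨C, 1, one_pos, fun N ε hε _ v g hv => ?_⟩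
  have hε0 : 0 < ε := by rw [hε]; positivity
  have := isFiniteMeasure_rodMeasure hQ ε
  set l := ε ^ (1 / 4 : ℝ) with hl
  have hl0 : 0 < l := Real.rpow_pos_of_pos hε0 _
  have hlinv : ε ^ (-(1 / 4) : ℝ) = l⁻¹ := Real.rpow_neg hε0.le _
  have hscale : ε ^ (-(3 / 4) : ℝ) = ε⁻¹ * l := by
    rw [hl, ← Real.rpow_neg_one, ← Real.rpow_add hε0]; norm_num
  have hae : ∀ᵐ z ∂(rodMeasure Q ε), l • z ∈ rod Q ε := by
    have hm : MeasurableSet (ε ^ (-(1 / 4) : ℝ) • rod Q ε) :=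
      (hQ.measurableSet_rod ε).const_smul₀ _
    refine Measure.ae_smul_measure ?_ _
    filter_upwards [ae_restrict_mem hm] with z hz
    rwa [hlinv, mem_smul_set_iff_inv_smul_mem₀ (inv_ne_zero hl0.ne'), inv_inv] at hz
  have hosc : ∫ z, Set.indicator {y | 0 < F (l * z.1) y} (w (l * z.1))
      (ε ^ (-(3 / 4) : ℝ) • z) * v z ^ 2 ∂(rodMeasure Q ε) =
        ∫ z, cellDensity Q F w ((l • z).1, wrap (ε⁻¹ • l • z)) * v z ^ 2 ∂(rodMeasure Q ε) := by
    refine integral_congr_ae ?_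
    filter_upwards [hae] with z hz
    rw [hF.cellDensity_wrap hw hz.1 (inv_smul_snd_mem_of_mem_rod hε0 hz), hscale, smul_smul]
    rfl
  have hmean : (volume.real (cell Q))⁻¹ *
      ∫ z, volume.real (perforatedCell Q F (l * z.1)) * cellAverage Q F w (l * z.1) * v z ^ 2
        ∂(rodMeasure Q ε) =
        ∫ z, cellMean Q (cellDensity Q F w) (l • z).1 * v z ^ 2 ∂(rodMeasure Q ε) := by
    rw [← integral_const_mul]
    refine integral_congr_ae ?_
    filter_upwards [hae] with z hz
    rw [hF.cellMean_cellDensity hQ hz.1, volume_real_mul_cellAverage _ hQ, mul_assoc]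
    rfl
  rw [hosc, hmean, ← hH.integral_rodDeviation_comp_mul_sq hv.1 (measurable_const_smul l)]
  have h := hv.abs_integral_mul_sq_le (C := C * ε ^ (3 / 4 : ℝ))
    ((hH.measurable_rodDeviation ε).comp (measurable_const_smul l))
    (fun z => hH.abs_rodDeviation_le ε _) (by positivity) fun φ hφ hφ0 => by
      refine (abs_integral_rodMeasure_le hε0 (hC N ε hε)
        (hφ.of_le (by exact_mod_cast le_top)) hφ0).trans (le_of_eq (by ring))
  exact h.trans (le_of_eq (by ring))

end Main

end ThinRod

theorem mainTheorem2 {n : ℕ} (hn : 1 ≤ n) (Q : Set (Cross n)) (hQ : IsLipschitzDomain Q)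
    (hQ0 : (0 : Cross n) ∈ Q) (α : ℝ) (hα : 0 < α)
    (F : ℝ → Space n → ℝ) (hF : IsPerforation Q α F) :
    (∀ w : ℝ → Space n → ℝ, IsC1HolderWeight Q α w →
      ∃ C ε₀ : ℝ, 0 < ε₀ ∧ ∀ (N : ℕ) (ε : ℝ), ε = 1 / (2 * (N : ℝ) + 1) → ε < ε₀ →
        ∀ (v : Space n → ℝ) (g : Space n → Space n), InH10Rod Q ε v g →
          |(∫ x in perforatedRod Q F ε, w x.1 (ε⁻¹ • x) * v x ^ 2) -
              (volume.real (cell Q))⁻¹ *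
                ∫ x in rod Q ε, (∫ y in perforatedCell Q F x.1, w x.1 y) * v x ^ 2| ≤
            C * (ε * normL2 (volume.restrict (rod Q ε)) v *
              normL2Vec (volume.restrict (rod Q ε)) g)) ∧
    (∀ c : ℝ → Space n → ℝ, IsC1HolderWeight Q α c →
      ∃ C ε₀ : ℝ, 0 < ε₀ ∧ ∀ (N : ℕ) (ε : ℝ), ε = 1 / (2 * (N : ℝ) + 1) → ε < ε₀ →
        ∀ (v : Space n → ℝ) (g : Space n → Space n),
          InSobolevVanishing (rodMeasure Q ε) (ε ^ (-(1 / 4) : ℝ) • rodEnds Q ε) v g →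
          |(∫ z, Set.indicator {y | 0 < F (ε ^ (1 / 4 : ℝ) * z.1) y} (c (ε ^ (1 / 4 : ℝ) * z.1))
                (ε ^ (-(3 / 4) : ℝ) • z) * v z ^ 2 ∂(rodMeasure Q ε)) -
              (volume.real (cell Q))⁻¹ *
                ∫ z, volume.real (perforatedCell Q F (ε ^ (1 / 4 : ℝ) * z.1)) *
                  cellAverage Q F c (ε ^ (1 / 4 : ℝ) * z.1) * v z ^ 2 ∂(rodMeasure Q ε)| ≤
            C * (ε ^ (3 / 4 : ℝ) * normL2 (rodMeasure Q ε) v *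
              normL2Vec (rodMeasure Q ε) g)) :=
  ⟨fun _ hw => exists_rod_estimate hQ hα hF hw,
    fun _ hc => exists_rescaled_rod_estimate hQ hα hF hc⟩
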